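/- Let $F(x)=f(x)+\psi(x)$ on $\mathbb{R}^n$, where $f:\mathbb{R}^n\to\mathbb{R}$ is convex and differentiable and $\psi(x)=\sum_{i=1}^n\psi^i(x^i)$ with each $\psi^i:\mathbb{R}\to\mathbb{R}\cup\{+\infty\}$ proper, closed and convex. For a positive vector $v$ write $\|x\|_v^2=\sum_i v_i(x^i)^2$. Let $x_*$ be a minimizer of $F$ and let $\mu_F(v)>0$ satisfy $F(x)\ge F(x_*)+\frac{\mu_F(v)}{2}\|x-x_*\|_v^2$ for all $x\in\mathbb{R}^n$. Let $\hat S$ be a random subset of $\{1,\dots,n\}$ with $\mathbf{P}(i\in\hat S)=\mathbf{P}(j\in\hat S)$ for all $i,j$ and $\tau=\mathbf{E}|\hat S|>0$, and assume that, with $h_{[S]}=\sum_{i\in S}h^ie_i$, $$\mathbf{E}\big[f(x+h_{[\hat S]})\big]\le f(x)+\frac{\tau}{n}\Big(\langle\nabla f(x),h\rangle+\tfrac12\|h\|_v^2\Big)\qquad\text{for all }x,h\in\mathbb{R}^n.$$ *Scalar sequences.* Let $\theta_0=\tau/n$, $\theta_{k+1}=\frac12\big(\sqrt{\theta_k^4+4\theta_k^2}-\theta_k^2\big)$,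 and use the convention $1/\theta_{-1}^2:=(1-\theta_0)/\theta_0^2$. Let $\gamma_0^0=1$, $\gamma_1^0=0$, $\gamma_1^1=1$ and, for $k\ge1$, $\gamma_{k+1}^i=(1-\theta_k)\gamma_k^i$ for $i\le k-1$, $\gamma_{k+1}^k=\theta_k(1-\frac n\tau\theta_{k-1})+\frac n\tau(\theta_{k-1}-\theta_k)$, $\gamma_{k+1}^{k+1}=\frac n\tau\theta_k$. For $k\ge1$ put $$\beta_k=\frac1{\theta_0\theta_{k-1}}-\frac{1-\theta_0}{\theta_0^2},\qquad D_k=\sum_{i=0}^{k-1}\frac{\gamma_k^i}{\theta_{i-1}^2}+\beta_k,\qquad m_k(\mu)=\frac{\mu\theta_0^2}{1+\mu(1-\theta_0)}D_k .$$ *Restarted APPROX.* Fix $\sigma\in(0,1)$, a period $K\ge1$, and $x_0\in\mathbb{R}^n$. A run started at $a$ sets $x_0=z_0=a$; its $k$-th iteration forms $y_k=(1-\theta_k)x_k+\theta_kz_k$, draws $S_k\sim\hat S$ independently of the past, sets $$z_{k+1}^i=\arg\min_{z\in\mathbb{R}}\Big\{\nabla_if(y_k)(z-y_k^i)+\frac{\theta_knv_i}{2\tau}|z-z_k^i|^2+\psi^i(z)\Big\}\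 (i\in S_k),\qquad z_{k+1}^i=z_k^i\ (i\notin S_k),$$ and $x_{k+1}=y_k+\frac n\tau\theta_k(z_{k+1}-z_k)$. The restart point after $k\ge1$ iterations of a run is $$\bar x_k=\sigma x_k+(1-\sigma)\mathring x_k,\qquad \mathring x_k=\frac1{D_k}\Big(\sum_{i=0}^{k-1}\frac{\gamma_k^i}{\theta_{i-1}^2}x_i+\beta_kx_k\Big).$$ Restarted APPROX starts a run at $x_0$. Counting iterations globally from $0$, every iteration $k$ that meets the restart test replaces $x_{k+1}$ by the restart point of the current run and starts a new run there (so $z_{k+1}=x_{k+1}$ and $\theta$ is reset to $\theta_0$). The restart test is either $k\equiv0\pmod K$ or $k+1\equiv0\pmod K$; the result holds for each of the two. Let $x_k$ ($k\ge 0$) now denote the resulting globally indexed iterates. **Theorem.** Let $$\Delta(x)=\frac{1-\theta_0}{\theta_0^2}\big(F(x)-F(x_*)\big)+\frac1{2\theta_0^2}\|x-x_*\|_v^2\in[0,+\infty]\qquad(0\cdot\infty=0).$$ For every $K\ge1$ and $\sigma\in(0,1)$, the rate $\rho=\max\big(\sigma,1-\sigma m_K(\mu_F(v))\big)^{1/K}$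 lies in $(0,1)$, and $$\mathbf{E}[\Delta(x_k)]\le\rho^{\,k-K}\,\Delta(x_0)\qquad\text{for all }k\ge K .$$ In particular the method, which does not use $\mu_F(v)$, converges linearly. -/

import Mathlib

open MeasureTheory ProbabilityTheory

namespace RestartedApprox

noncomputable section

/-! ### The composite problem -/

/-- A proper closed convex function on the line with values in `(-∞, +∞]`:
the epigraph is closed and convex, and the function is finite somewhere. -/
structure IsClosedConvexFun (φ : ℝ → EReal) : Prop where
  ne_bot : ∀ t, φ t ≠ ⊥
  proper : ∃ t, φ t ≠ ⊤
  convex_epigraph : Convex ℝ {q : ℝ × ℝ | φ q.1 ≤ (q.2 : EReal)}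
  closed_epigraph : IsClosed {q : ℝ × ℝ | φ q.1 ≤ (q.2 : EReal)}

/-- The objective `F(x) = f(x) + ∑ i, ψ i (x i)`. -/
def objective {n : ℕ} (f : (Fin n → ℝ) → ℝ) (ψ : Fin n → ℝ → EReal) (x : Fin n → ℝ) : EReal :=
  (f x : EReal) + ∑ i, ψ i (x i)

/-- The squared weighted norm `∑ i, v i * (x i) ^ 2`. -/
def wnormSq {n : ℕ} (v x : Fin n → ℝ) : ℝ :=
  ∑ i, v i * x i ^ 2

/-- The `i`-th partial derivative of `f` at `x`. -/
def partialDeriv {n : ℕ} (f : (Fin n → ℝ) → ℝ) (i : Fin n) (x : Fin n → ℝ) : ℝ :=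
  fderiv ℝ f x (Pi.single i 1)

/-- `F(x) ≥ F(xstar) + (μ / 2) * ‖x - xstar‖_v ^ 2` for all `x`. -/
def StrongConvexityAt {n : ℕ} (f : (Fin n → ℝ) → ℝ) (ψ : Fin n → ℝ → EReal)
    (v xstar : Fin n → ℝ) (μ : ℝ) : Prop :=
  ∀ x, objective f ψ xstar + ((μ / 2 * wnormSq v (x - xstar) : ℝ) : EReal) ≤ objective f ψ x

/-! ### Samplings and expected separable overapproximation -/

/-- The law `p` of a random subset of `[n]` is uniform if all coordinates are
selected with the same probability. -/
def IsUniformSampling {n : ℕ} (p : PMF (Finset (Fin n))) : Prop :=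
  ∀ i j : Fin n, (∑ A with i ∈ A, p A) = ∑ A with j ∈ A, p A

/-- The expected cardinality `τ` of the random subset. -/
def tau {n : ℕ} (p : PMF (Finset (Fin n))) : ℝ :=
  ∑ A, (p A).toReal * (A.card : ℝ)

/-- The vector that agrees with `h` on `A` and vanishes off `A`. -/
def restrictTo {n : ℕ} (A : Finset (Fin n)) (h : Fin n → ℝ) : Fin n → ℝ :=
  fun i => if i ∈ A then h i else 0

/-- The expected separable overapproximation `(f, Ŝ) ∼ ESO(v)`, where `Ŝ` has law `p`. -/
def ESO {n : ℕ} (f : (Fin n → ℝ) → ℝ) (p : PMF (Finset (Fin n))) (v : Fin n → ℝ) : Prop :=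
  ∀ x h : Fin n → ℝ,
    ∑ A, (p A).toReal * f (x + restrictTo A h) ≤
      f x + tau p / n * (∑ i, partialDeriv f i x * h i + 1 / 2 * wnormSq v h)

/-! ### The scalar sequences -/

/-- `θ₀` given, and `θ_{k+1} = (√(θ_k⁴ + 4 θ_k²) - θ_k²) / 2`. -/
def theta (θ₀ : ℝ) : ℕ → ℝ
  | 0 => θ₀
  | k + 1 => (Real.sqrt (theta θ₀ k ^ 4 + 4 * theta θ₀ k ^ 2) - theta θ₀ k ^ 2) / 2

/-- `invSq θ₀ i` is `1 / θ_{i-1}²`, with the convention `1 / θ_{-1}² = (1 - θ₀) / θ₀²`. -/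
def invSq (θ₀ : ℝ) : ℕ → ℝ
  | 0 => (1 - θ₀) / θ₀ ^ 2
  | i + 1 => 1 / theta θ₀ i ^ 2

/-- The coefficients: `gamma θ₀ k i` is `γ_k^i` (zero for `i > k`). As `θ₀ = τ / n`, the
factor `n / τ` is written `1 / θ₀`. -/
def gamma (θ₀ : ℝ) : ℕ → ℕ → ℝ
  | 0, i => if i = 0 then 1 else 0
  | 1, i => if i = 1 then 1 else 0
  | k + 2, i =>
    if i < k + 1 then (1 - theta θ₀ (k + 1)) * gamma θ₀ (k + 1) i
    else if i = k + 1 then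
      theta θ₀ (k + 1) * (1 - 1 / θ₀ * theta θ₀ k) + 1 / θ₀ * (theta θ₀ k - theta θ₀ (k + 1))
    else if i = k + 2 then 1 / θ₀ * theta θ₀ (k + 1)
    else 0

/-- The weight `1 / (θ₀ θ_{k-1}) - (1 - θ₀) / θ₀²` of the last iterate, for `k ≥ 1`. -/
def lastWeight (θ₀ : ℝ) (k : ℕ) : ℝ :=
  1 / (θ₀ * theta θ₀ (k - 1)) - (1 - θ₀) / θ₀ ^ 2

/-- `∑_{i < k} γ_k^i / θ_{i-1}² + 1 / (θ₀ θ_{k-1}) - (1 - θ₀) / θ₀²`, for `k ≥ 1`. -/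
def totalWeight (θ₀ : ℝ) (k : ℕ) : ℝ :=
  ∑ i ∈ Finset.range k, gamma θ₀ k i * invSq θ₀ i + lastWeight θ₀ k

/-- `m_k(μ)`, for `k ≥ 1`. -/
def mCoeff (θ₀ : ℝ) (k : ℕ) (μ : ℝ) : ℝ :=
  μ * θ₀ ^ 2 / (1 + μ * (1 - θ₀)) * totalWeight θ₀ k

/-! ### The restart point -/

/-- The weighted average of the iterates `x 0, …, x k` of one run, for `k ≥ 1`. -/
def ringPoint {n : ℕ} (θ₀ : ℝ) (x : ℕ → Fin n → ℝ) (k : ℕ) : Fin n → ℝ :=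
  (1 / totalWeight θ₀ k) •
    (∑ i ∈ Finset.range k, (gamma θ₀ k i * invSq θ₀ i) • x i + lastWeight θ₀ k • x k)

/-- The restart point `σ x_k + (1 - σ) x̊_k`. -/
def barPoint {n : ℕ} (θ₀ σ : ℝ) (x : ℕ → Fin n → ℝ) (k : ℕ) : Fin n → ℝ :=
  σ • x k + (1 - σ) • ringPoint θ₀ x k

/-! ### The algorithm -/

/-- A global minimizer of `g` over the line (arbitrary if there is none). -/
def argmin (g : ℝ → EReal) : ℝ :=
  Classical.epsilon fun t => ∀ w, g t ≤ g w

/-- The minimizer over `t` of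
`∂_i f(y) (t - y_i) + (θ n v_i / (2 τ)) |t - z_i|² + ψ_i(t)`. -/
def coordUpdate {n : ℕ} (f : (Fin n → ℝ) → ℝ) (ψ : Fin n → ℝ → EReal) (v : Fin n → ℝ)
    (τ θ : ℝ) (y z : Fin n → ℝ) (i : Fin n) : ℝ :=
  argmin fun t =>
    ((partialDeriv f i y * (t - y i) + θ * n * v i / (2 * τ) * |t - z i| ^ 2 : ℝ) : EReal) + ψ i t

/-- The memory of the algorithm: the number `age` of iterations since the last restart, the
iterates `xs 0, …, xs age` produced since then, and the current point `z`. -/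
structure State (n : ℕ) where
  age : ℕ
  xs : ℕ → Fin n → ℝ
  z : Fin n → ℝ

/-- The current iterate `x_k`. -/
def State.x {n : ℕ} (s : State n) : Fin n → ℝ := s.xs s.age

/-- The state just after a start, or restart, at the point `a`. -/
def State.start {n : ℕ} (a : Fin n → ℝ) : State n := ⟨0, fun _ => a, a⟩

/-- One iteration of APPROX with selected coordinates `A`. The parameter `θ_k` is reset to
`θ₀ = τ / n` at each restart, hence is always the term of index `age` of `theta θ₀`. -/
def approxStep {n : ℕ} (f : (Fin n → ℝ) → ℝ) (ψ : Fin n → ℝ → EReal) (v : Fin n → ℝ) (τ : ℝ)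
    (A : Finset (Fin n)) (s : State n) : State n :=
  let θ := theta (τ / n) s.age
  let y : Fin n → ℝ := (1 - θ) • s.x + θ • s.z
  let z' : Fin n → ℝ := fun i => if i ∈ A then coordUpdate f ψ v τ θ y s.z i else s.z i
  let x' : Fin n → ℝ := y + (n / τ * θ) • (z' - s.z)
  ⟨s.age + 1, Function.update s.xs (s.age + 1) x', z'⟩

/-- Restarted APPROX driven by the sequence of coordinate sets `S 0, S 1, …`. Iteration `k`
ends with a restart when `k + e ≡ 0 (mod K)`. With `e = 0` the restart points are
`x_1, x_{K+1}, x_{2K+1}, …`; with `e = 1` they are `x_K, x_{2K}, x_{3K}, …`. -/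
def restartedApprox {n : ℕ} (f : (Fin n → ℝ) → ℝ) (ψ : Fin n → ℝ → EReal) (v : Fin n → ℝ)
    (τ σ : ℝ) (K e : ℕ) (x₀ : Fin n → ℝ) (S : ℕ → Finset (Fin n)) : ℕ → State n
  | 0 => State.start x₀
  | k + 1 =>
    let s := approxStep f ψ v τ (S k) (restartedApprox f ψ v τ σ K e x₀ S k)
    if (k + e) % K = 0 then State.start (barPoint (τ / n) σ s.xs s.age) else s

/-! ### The Lyapunov function -/

/-- `Δ(x) = (1 - θ₀) / θ₀² * (F(x) - F(xstar)) + 1 / (2 θ₀²) * ‖x - xstar‖_v²`, as an element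
of `[0, +∞]`, with `0 * ∞ = 0`. -/
def Delta {n : ℕ} (f : (Fin n → ℝ) → ℝ) (ψ : Fin n → ℝ → EReal) (v : Fin n → ℝ) (θ₀ : ℝ)
    (xstar x : Fin n → ℝ) : ENNReal :=
  ENNReal.ofReal ((1 - θ₀) / θ₀ ^ 2) * (objective f ψ x - objective f ψ xstar).toENNReal +
    ENNReal.ofReal (1 / (2 * θ₀ ^ 2) * wnormSq v (x - xstar))

end

end RestartedApprox

namespace RestartedApprox

/-! ### Scalar sequences -/

/-! Within one run, `x_k = ∑ γ_k^i z_i`, so by convexity `Ψ_k = ∑ γ_k^i ψ(z_i)` bounds `ψ(x_k)` from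
above. Being linear in the values `ψ(z_i)`, `Ψ_k` has an exactly computable conditional expectation.
The ESO inequality, the prox inequality and the gradient inequality for `f` give a one-step estimate
(`approx_step_expectation`). Divided by `θ_k²`, with `(1 - θ_k)/θ_k² = 1/θ_{k-1}²`, it says that the
potential `(f(x_k) + Ψ_k - F(x_*))/θ_{k-1}² + ‖z_k - x_*‖_v²/(2θ₀²)` does not increase in
expectation; at `k = 0` it equals `Δ(a)`, where `a` is the starting point.

Average these bounds over `i ≤ k` with the weights `γ_k^i`. Convexity of the squared norm produces
`‖x_k - x_*‖_v²`. The weights of the objective gaps leave enough on `x_k` to complete `Δ(x_k)`, and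
the rest, of total mass `D_k`, dominates `D_k (F(x̊_k) - F(x_*))`. Strong convexity bounds that
below by `m_k Δ(x̊_k)`. Hence `E Δ(x_k) + m_k E Δ(x̊_k) ≤ E Δ(a)` (`integral_realDelta_run_add_le`).
In particular neither `x_k` nor, by convexity of `Δ`, `x̊_k` is worse than `a` in expectation, and
mixing the two with `σ` contracts by `max(σ, 1 - σ m_k)` (`integral_realDelta_barPoint_le`).

Chaining the complete runs of length `K` gives one such factor per run. The exponent `k - K` absorbs
the last unfinished run and, for one of the two tests, the initial run of length one.

The value `+∞` matters only for the starting point. If `x₀` is outside the domain of `ψ` and `θ₀ <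
1`, the bound is trivial. If `θ₀ = 1`, almost surely all coordinates are updated, so the first
iteration enters the domain, and every coefficient that would multiply the value at `x₀` is zero. -/

theorem theta_pos {θ₀ : ℝ} (h : 0 < θ₀) : ∀ k, 0 < theta θ₀ k
  | 0 => h
  | k + 1 => by
    have hk := theta_pos h k
    have : theta θ₀ k ^ 2 < Real.sqrt (theta θ₀ k ^ 4 + 4 * theta θ₀ k ^ 2) := by
      apply Real.lt_sqrt_of_sq_lt
      nlinarith [pow_pos hk 2]
    simp only [theta]
    linarith

theorem theta_succ_sq {θ₀ : ℝ} (k : ℕ) :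
    theta θ₀ (k + 1) ^ 2 = (1 - theta θ₀ (k + 1)) * theta θ₀ k ^ 2 := by
  have h : Real.sqrt (theta θ₀ k ^ 4 + 4 * theta θ₀ k ^ 2) ^ 2 =
      theta θ₀ k ^ 4 + 4 * theta θ₀ k ^ 2 := Real.sq_sqrt (by positivity)
  simp only [theta]
  linear_combination h / 4

theorem theta_succ_lt_one {θ₀ : ℝ} (h : 0 < θ₀) (k : ℕ) : theta θ₀ (k + 1) < 1 := by
  have h1 := theta_succ_sq (θ₀ := θ₀) k
  have h2 := theta_pos h (k + 1)
  have h3 := theta_pos h k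
  by_contra! hc
  nlinarith [pow_pos h2 2, pow_pos h3 2]

theorem theta_succ_le {θ₀ : ℝ} (h : 0 < θ₀) (k : ℕ) : theta θ₀ (k + 1) ≤ theta θ₀ k := by
  have h1 := theta_succ_sq (θ₀ := θ₀) k
  have h2 := theta_pos h (k + 1)
  have h3 := theta_pos h k
  refine le_of_sq_le_sq ?_ h3.le
  nlinarith [pow_pos h3 2]

theorem theta_le {θ₀ : ℝ} (h : 0 < θ₀) : ∀ k, theta θ₀ k ≤ θ₀
  | 0 => le_rfl
  | k + 1 => (theta_succ_le h k).trans (theta_le h k)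

theorem theta_le_one {θ₀ : ℝ} (h : 0 < θ₀) (h1 : θ₀ ≤ 1) (k : ℕ) : theta θ₀ k ≤ 1 :=
  (theta_le h k).trans h1

/-- This is what makes the one-step estimates telescope. The convention for `1/θ_{-1}²` is chosen so
that it also holds at `k = 0`. -/
theorem invSq_eq {θ₀ : ℝ} (h : 0 < θ₀) (k : ℕ) :
    invSq θ₀ k = (1 - theta θ₀ k) / theta θ₀ k ^ 2 := by
  cases k with
  | zero => rfl
  | succ k =>
    have h2 := theta_pos h (k + 1)
    have h3 := theta_pos h k
    have h1 := theta_succ_sq (θ₀ := θ₀) k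
    simp only [invSq]
    rw [div_eq_div_iff (by positivity) (by positivity)]
    linarith

theorem invSq_nonneg {θ₀ : ℝ} (h : 0 < θ₀) (h1 : θ₀ ≤ 1) (k : ℕ) : 0 ≤ invSq θ₀ k := by
  rw [invSq_eq h]
  have := theta_le_one h h1 k
  have := sub_nonneg.2 this
  positivity

theorem gamma_succ_zero {θ₀ : ℝ} : ∀ k, gamma θ₀ (k + 1) 0 = 0
  | 0 => by simp [gamma]
  | k + 1 => by
    have := gamma_succ_zero (θ₀ := θ₀) k
    simp [gamma, this]

theorem gamma_succ_self {θ₀ : ℝ} (h : 0 < θ₀) (k : ℕ) :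
    gamma θ₀ (k + 1) (k + 1) = theta θ₀ k / θ₀ := by
  cases k with
  | zero => simp [gamma, theta, h.ne']
  | succ k => simp [gamma, div_eq_inv_mul]

theorem gamma_nonneg {θ₀ : ℝ} (h : 0 < θ₀) : ∀ k i, 0 ≤ gamma θ₀ k i
  | 0, i => by simp only [gamma]; split_ifs <;> norm_num
  | 1, i => by simp only [gamma]; split_ifs <;> norm_num
  | k + 2, i => by
    have h1 := gamma_nonneg h (k + 1) i
    have h2 := theta_pos h (k + 1)
    have h3 := theta_succ_le h k
    have h4 := theta_succ_lt_one h k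
    have h5 : theta θ₀ k / θ₀ ≤ 1 := (div_le_one h).2 (theta_le h k)
    simp only [gamma]
    split_ifs
    · exact mul_nonneg (by linarith) h1
    -- Both summands are nonnegative because `θ` is nonincreasing and bounded by `θ₀`.
    · refine add_nonneg (mul_nonneg h2.le ?_) (mul_nonneg (by positivity) (by linarith))
      rw [one_div_mul_eq_div]
      linarith
    · positivity
    · exact le_rfl

/-- The recursion satisfied by every sequence of averages `∑ i ≤ k, γ_k^i g_i`. -/
theorem sum_gamma_smul_succ {E : Type*} [AddCommGroup E] [Module ℝ E] {θ₀ : ℝ} (h : 0 < θ₀)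
    (g : ℕ → E) (k : ℕ) :
    ∑ i ∈ Finset.range (k + 2), gamma θ₀ (k + 1) i • g i =
      (1 - theta θ₀ k) • ∑ i ∈ Finset.range (k + 1), gamma θ₀ k i • g i + theta θ₀ k • g k +
        (theta θ₀ k / θ₀) • (g (k + 1) - g k) := by
  cases k with
  | zero =>
    simp only [Finset.sum_range_succ, Finset.sum_range_zero, gamma, theta, div_self h.ne']
    simp
    module
  | succ k =>
    rw [Finset.sum_range_succ, Finset.sum_range_succ, gamma_succ_self h,
      Finset.sum_range_succ _ (k + 1), gamma_succ_self h, smul_add, Finset.smul_sum]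
    have h1 : ∑ i ∈ Finset.range (k + 1), gamma θ₀ (k + 1 + 1) i • g i =
        ∑ i ∈ Finset.range (k + 1), (1 - theta θ₀ (k + 1)) • gamma θ₀ (k + 1) i • g i := by
      refine Finset.sum_congr rfl fun i hi => ?_
      rw [smul_smul]
      simp only [gamma, if_pos (Finset.mem_range.1 hi)]
    have h2 : gamma θ₀ (k + 1 + 1) (k + 1) =
        theta θ₀ (k + 1) * (1 - 1 / θ₀ * theta θ₀ k) +
          1 / θ₀ * (theta θ₀ k - theta θ₀ (k + 1)) := by
      simp [gamma]
    rw [h1, h2]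
    match_scalars <;> field_simp
    ring

theorem sum_gamma {θ₀ : ℝ} (h : 0 < θ₀) (k : ℕ) :
    ∑ i ∈ Finset.range (k + 1), gamma θ₀ k i = 1 := by
  induction k with
  | zero => simp [gamma]
  | succ k ih =>
    have := sum_gamma_smul_succ h (fun _ => (1 : ℝ)) k
    simp only [smul_eq_mul, mul_one, sub_self, mul_zero, add_zero] at this
    rw [this, ih]
    ring

/-- The averaged potentials carry the weight `γ_k^k/θ_{k-1}²` on the gap at the last iterate. The
part subtracted here is set aside for `Δ(x_k)`; the remainder goes into the averaged point. -/
theorem lastWeight_eq {θ₀ : ℝ} (h : 0 < θ₀) (k : ℕ) :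
    lastWeight θ₀ (k + 1) =
      gamma θ₀ (k + 1) (k + 1) * invSq θ₀ (k + 1) - (1 - θ₀) / θ₀ ^ 2 := by
  have := theta_pos h k
  rw [gamma_succ_self h]
  simp only [lastWeight, invSq, Nat.add_sub_cancel]
  field_simp

theorem lastWeight_pos {θ₀ : ℝ} (h : 0 < θ₀) (k : ℕ) : 0 < lastWeight θ₀ k := by
  have h1 := theta_pos h (k - 1)
  have h2 := theta_le h (k - 1)
  have h3 : 1 / (θ₀ * θ₀) ≤ 1 / (θ₀ * theta θ₀ (k - 1)) :=
    one_div_le_one_div_of_le (by positivity) (by gcongr)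
  have h4 : 1 / (θ₀ * θ₀) - (1 - θ₀) / θ₀ ^ 2 = 1 / θ₀ := by
    field_simp
    ring
  have : 0 < 1 / θ₀ := by positivity
  unfold lastWeight
  linarith

theorem totalWeight_pos {θ₀ : ℝ} (h : 0 < θ₀) (h1 : θ₀ ≤ 1) (k : ℕ) : 0 < totalWeight θ₀ k :=
  add_pos_of_nonneg_of_pos
    (Finset.sum_nonneg fun _ _ => mul_nonneg (gamma_nonneg h _ _) (invSq_nonneg h h1 _))
    (lastWeight_pos h k)

theorem mCoeff_pos {θ₀ μ : ℝ} (h : 0 < θ₀) (h1 : θ₀ ≤ 1) (hμ : 0 < μ) (k : ℕ) :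
    0 < mCoeff θ₀ k μ := by
  have := totalWeight_pos h h1 k
  have h2 := sub_nonneg.2 h1
  unfold mCoeff
  positivity

/-- The normalized weight of `x i` in the averaged point of the `k`-th iteration. -/
noncomputable def ringWeight (θ₀ : ℝ) (k i : ℕ) : ℝ :=
  (if i = k then lastWeight θ₀ k else gamma θ₀ k i * invSq θ₀ i) / totalWeight θ₀ k

theorem ringWeight_nonneg {θ₀ : ℝ} (h : 0 < θ₀) (h1 : θ₀ ≤ 1) (k i : ℕ) :
    0 ≤ ringWeight θ₀ k i := by
  refine div_nonneg ?_ (totalWeight_pos h h1 k).le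
  split_ifs
  · exact (lastWeight_pos h k).le
  · exact mul_nonneg (gamma_nonneg h _ _) (invSq_nonneg h h1 _)

/-- Index `0` can be dropped because `γ_{k+1}^0 = 0`. Starting at `1` keeps the starting point,
possibly outside the domain, out of every later use of convexity. -/
theorem sum_ringWeight_smul {E : Type*} [AddCommGroup E] [Module ℝ E] (θ₀ : ℝ) (k : ℕ)
    (g : ℕ → E) :
    ∑ i ∈ Finset.Icc 1 (k + 1), ringWeight θ₀ (k + 1) i • g i =
      (1 / totalWeight θ₀ (k + 1)) •
        (∑ i ∈ Finset.range (k + 1), (gamma θ₀ (k + 1) i * invSq θ₀ i) • g i +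
          lastWeight θ₀ (k + 1) • g (k + 1)) := by
  rw [← Finset.insert_Icc_right_eq_Icc_add_one (by omega), Finset.sum_insert (by simp),
    Finset.sum_range_eq_add_Ico _ (by omega), gamma_succ_zero, smul_add, smul_add,
    Finset.smul_sum, add_comm]
  congr 1
  · rw [zero_mul, zero_smul, smul_zero, zero_add]
    refine Finset.sum_congr (by ext; simp) fun i hi => ?_
    rw [Finset.mem_Ico] at hi
    rw [ringWeight, if_neg (by omega), smul_smul, one_div_mul_eq_div]
  · rw [ringWeight, if_pos rfl, smul_smul, one_div_mul_eq_div]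

theorem sum_ringWeight {θ₀ : ℝ} (h : 0 < θ₀) (h1 : θ₀ ≤ 1) (k : ℕ) :
    ∑ i ∈ Finset.Icc 1 (k + 1), ringWeight θ₀ (k + 1) i = 1 := by
  have := sum_ringWeight_smul θ₀ k (fun _ => (1 : ℝ))
  simp only [smul_eq_mul, mul_one] at this
  rw [this]
  exact one_div_mul_cancel (totalWeight_pos h h1 (k + 1)).ne'

theorem sum_gamma_Icc {E : Type*} [AddCommGroup E] [Module ℝ E] (θ₀ : ℝ) (k : ℕ)
    (g : ℕ → E) :
    ∑ i ∈ Finset.Icc 1 (k + 1), gamma θ₀ (k + 1) i • g i =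
      ∑ i ∈ Finset.range (k + 2), gamma θ₀ (k + 1) i • g i := by
  rw [Finset.sum_range_eq_add_Ico _ (by omega), gamma_succ_zero, zero_smul, zero_add]
  exact Finset.sum_congr (by ext; simp; omega) fun _ _ => rfl

theorem ringPoint_eq {n : ℕ} (θ₀ : ℝ) (x : ℕ → Fin n → ℝ) (k : ℕ) :
    ringPoint θ₀ x (k + 1) = ∑ i ∈ Finset.Icc 1 (k + 1), ringWeight θ₀ (k + 1) i • x i :=
  (sum_ringWeight_smul θ₀ k x).symm

/-! ### Closed convex functions on the line -/

/-- Hahn–Banach separates the epigraph from a point just below the graph. The separating line is not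
vertical, since that point lies directly under a point of the epigraph. -/
theorem IsClosedConvexFun.exists_affine_minorant {φ : ℝ → EReal} (h : IsClosedConvexFun φ) :
    ∃ a b : ℝ, ∀ t r : ℝ, φ t ≤ r → a + b * t ≤ r := by
  obtain ⟨t₀, ht₀⟩ := h.proper
  obtain ⟨r₀, hr₀⟩ : ∃ r₀ : ℝ, φ t₀ = r₀ := ⟨_, (EReal.coe_toReal ht₀ (h.ne_bot t₀)).symm⟩
  have hnot : ((t₀, r₀ - 1) : ℝ × ℝ) ∉ {q : ℝ × ℝ | φ q.1 ≤ (q.2 : EReal)} := by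
    simp only [Set.mem_ofPred_eq, hr₀, EReal.coe_le_coe_iff]
    linarith
  obtain ⟨g, u, hu, hg⟩ := geometric_hahn_banach_point_closed h.convex_epigraph h.closed_epigraph hnot
  have hlin : ∀ t r : ℝ, g (t, r) = t * g (1, 0) + r * g (0, 1) := by
    intro t r
    have : ((t, r) : ℝ × ℝ) = t • (1, 0) + r • (0, 1) := by simp
    rw [this, map_add, map_smul, map_smul, smul_eq_mul, smul_eq_mul]
  have h0 := hg (t₀, r₀) hr₀.le
  rw [hlin] at hu h0
  have hpos : 0 < g (0, 1) := by linarith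
  refine ⟨u / g (0, 1), -g (1, 0) / g (0, 1), fun t r htr => ?_⟩
  have h1 := hg (t, r) htr
  rw [hlin] at h1
  rw [div_mul_eq_mul_div, ← add_div, div_le_iff₀ hpos]
  linarith

/-- The affine minorant makes the quadratically perturbed function coercive. Minimizing `q t + r`
over a compact truncation of the epigraph replaces an argument by lower semicontinuity. -/
theorem IsClosedConvexFun.exists_minimizer {φ : ℝ → EReal} (h : IsClosedConvexFun φ)
    (s y z κ : ℝ) (hκ : 0 < κ) :
    ∃ t : ℝ, φ t ≠ ⊤ ∧ ∀ w, ((s * (t - y) + κ * |t - z| ^ 2 : ℝ) : EReal) + φ t ≤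
      ((s * (w - y) + κ * |w - z| ^ 2 : ℝ) : EReal) + φ w := by
  obtain ⟨a, b, hab⟩ := h.exists_affine_minorant
  obtain ⟨t₀, ht₀⟩ := h.proper
  obtain ⟨r₀, hr₀⟩ : ∃ r₀ : ℝ, φ t₀ = r₀ := ⟨_, (EReal.coe_toReal ht₀ (h.ne_bot t₀)).symm⟩
  set q : ℝ → ℝ := fun t => s * (t - y) + κ * |t - z| ^ 2 with hq
  have hqc : Continuous q := by fun_prop
  set M := q t₀ + r₀ with hM
  set C : Set (ℝ × ℝ) := {p | φ p.1 ≤ (p.2 : EReal)} ∩ {p | q p.1 + p.2 ≤ M} with hC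
  have hCclosed : IsClosed C :=
    h.closed_epigraph.inter (isClosed_le (by fun_prop) continuous_const)
  set d := s + b
  set M' := M - s * (z - y) - a - b * z with hM'
  -- On `C` one has `κ s² + d s ≤ M'` for `s = t - z`, which forces `|s| ≤ R`.
  set R := (|d| + |M'|) / κ + 1 with hR
  have hbound : ∀ p ∈ C, p.1 ∈ Set.Icc (z - R) (z + R) := by
    rintro ⟨t, r⟩ ⟨h1, h2⟩
    have h3 := hab t r h1
    simp only [Set.mem_ofPred_eq, hq, sq_abs] at h2
    have h4 : κ * (t - z) ^ 2 + d * (t - z) ≤ M' := by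
      simp only [d, hM']
      linarith
    suffices |t - z| ≤ R by
      rw [abs_le] at this
      exact ⟨by linarith, by linarith⟩
    by_contra! hlt
    have h5 : κ * R = |d| + |M'| + κ := by
      rw [hR]
      field_simp
    have h6 : 1 ≤ R := by
      rw [hR]
      have : 0 ≤ (|d| + |M'|) / κ := by positivity
      linarith
    have h7 : -(|d| * |t - z|) ≤ d * (t - z) := by
      rw [← abs_mul]
      exact neg_abs_le _
    have h8 : (|d| + |M'| + κ) * |t - z| ≤ κ * (t - z) ^ 2 := by
      rw [← h5, ← sq_abs (t - z), sq]
      have : 0 ≤ |t - z| := abs_nonneg _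
      nlinarith [mul_le_mul_of_nonneg_left hlt.le (mul_nonneg hκ.le this)]
    nlinarith [le_abs_self M', abs_nonneg M', abs_nonneg (t - z)]
  obtain ⟨B₁, hB₁⟩ := (isCompact_Icc (a := z - R) (b := z + R)).exists_bound_of_continuousOn
    hqc.continuousOn
  obtain ⟨B₂, hB₂⟩ := (isCompact_Icc (a := z - R) (b := z + R)).exists_bound_of_continuousOn
    (f := fun t => a + b * t) (by fun_prop)
  have hCcomp : IsCompact C := by
    refine (isCompact_Icc (a := z - R) (b := z + R)).prod
      (isCompact_Icc (a := -B₂) (b := M + B₁)) |>.of_isClosed_subset hCclosed ?_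
    intro p hp
    have h1 := hbound p hp
    have h2 := abs_le.1 (hB₁ _ h1)
    have h3 := abs_le.1 (hB₂ _ h1)
    have h4 := hab p.1 p.2 hp.1
    have h5 : q p.1 + p.2 ≤ M := hp.2
    exact ⟨h1, by linarith, by linarith⟩
  have hmem₀ : ((t₀, r₀) : ℝ × ℝ) ∈ C := ⟨hr₀.le, hM.symm.le⟩
  obtain ⟨⟨t, r⟩, ht, hmin⟩ := hCcomp.exists_isMinOn ⟨_, hmem₀⟩
    (f := fun p => q p.1 + p.2) (by fun_prop)
  have htr : φ t ≤ r := ht.1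
  have htop : φ t ≠ ⊤ := (htr.trans_lt (EReal.coe_lt_top r)).ne
  refine ⟨t, htop, fun w => ?_⟩
  change (q t : EReal) + φ t ≤ (q w : EReal) + φ w
  by_cases hw : φ w = ⊤
  · rw [hw, EReal.coe_add_top]
    exact le_top
  obtain ⟨rw', hrw⟩ : ∃ r : ℝ, φ w = r := ⟨_, (EReal.coe_toReal hw (h.ne_bot w)).symm⟩
  calc (q t : EReal) + φ t ≤ (q t : EReal) + r := by gcongr
    _ = ((q t + r : ℝ) : EReal) := (EReal.coe_add _ _).symm
    _ ≤ ((q w + rw' : ℝ) : EReal) := by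
      rw [EReal.coe_le_coe_iff]
      by_cases hwC : q w + rw' ≤ M
      · exact hmin (show ((w, rw') : ℝ × ℝ) ∈ C from ⟨hrw.le, hwC⟩)
      · have := hmin hmem₀
        simp only [Set.mem_ofPred_eq] at this
        linarith
    _ = (q w : EReal) + φ w := by rw [hrw, EReal.coe_add]

theorem IsClosedConvexFun.convexOn_toReal {φ : ℝ → EReal} (h : IsClosedConvexFun φ) :
    ConvexOn ℝ {t | φ t ≠ ⊤} (fun t => (φ t).toReal) := by
  have key : ∀ ⦃s⦄, φ s ≠ ⊤ → ∀ ⦃t⦄, φ t ≠ ⊤ → ∀ ⦃a b : ℝ⦄, 0 ≤ a → 0 ≤ b → a + b = 1 →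
      φ (a • s + b • t) ≤ ((a • (φ s).toReal + b • (φ t).toReal : ℝ) : EReal) := by
    intro s hs t ht a b ha hb hab
    have h1 : ((s, (φ s).toReal) : ℝ × ℝ) ∈ {q : ℝ × ℝ | φ q.1 ≤ (q.2 : EReal)} :=
      (EReal.coe_toReal hs (h.ne_bot s)).ge
    have h2 : ((t, (φ t).toReal) : ℝ × ℝ) ∈ {q : ℝ × ℝ | φ q.1 ≤ (q.2 : EReal)} :=
      (EReal.coe_toReal ht (h.ne_bot t)).ge
    exact h.convex_epigraph h1 h2 ha hb hab
  refine ⟨fun s hs t ht a b ha hb hab => ?_, fun s hs t ht a b ha hb hab => ?_⟩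
  · exact ((key hs ht ha hb hab).trans_lt (EReal.coe_lt_top _)).ne
  · exact EReal.toReal_le_toReal (key hs ht ha hb hab) (h.ne_bot _) (EReal.coe_ne_top _)

/-! ### The objective on its domain -/

/-- The set where the objective is finite. -/
def domain {n : ℕ} (ψ : Fin n → ℝ → EReal) : Set (Fin n → ℝ) := {x | ∀ i, ψ i (x i) ≠ ⊤}

/-- The separable term, as a real number (meaningful on the domain). -/
noncomputable def separable {n : ℕ} (ψ : Fin n → ℝ → EReal) (x : Fin n → ℝ) : ℝ :=
  ∑ i, (ψ i (x i)).toReal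

section Objective

variable {n : ℕ} {f : (Fin n → ℝ) → ℝ} {ψ : Fin n → ℝ → EReal}

theorem convexOn_separable (hψ : ∀ i, IsClosedConvexFun (ψ i)) :
    ConvexOn ℝ (domain ψ) (separable ψ) := by
  refine ⟨fun x hx y hy a b ha hb hab i => (hψ i).convexOn_toReal.1 (hx i) (hy i) ha hb hab,
    fun x hx y hy a b ha hb hab => ?_⟩
  simp only [separable, smul_eq_mul, Finset.mul_sum, ← Finset.sum_add_distrib]
  exact Finset.sum_le_sum fun i _ =>
    (hψ i).convexOn_toReal.2 (hx i) (hy i) ha hb hab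

theorem objective_eq_coe (hψ : ∀ i, IsClosedConvexFun (ψ i)) {x : Fin n → ℝ}
    (hx : x ∈ domain ψ) : objective f ψ x = ((f x + separable ψ x : ℝ) : EReal) := by
  have (s : Finset (Fin n)) :
      ∑ i ∈ s, ψ i (x i) = ((∑ i ∈ s, (ψ i (x i)).toReal : ℝ) : EReal) := by
    induction s using Finset.cons_induction with
    | empty => simp
    | cons a s ha ih =>
      rw [Finset.sum_cons, Finset.sum_cons, ih, EReal.coe_add,
        EReal.coe_toReal (hx a) ((hψ a).ne_bot _)]
  rw [objective, this, EReal.coe_add, separable]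

theorem objective_eq_top (hψ : ∀ i, IsClosedConvexFun (ψ i)) {x : Fin n → ℝ}
    (hx : x ∉ domain ψ) : objective f ψ x = ⊤ := by
  simp only [domain, Set.mem_ofPred_eq, not_forall, not_not] at hx
  obtain ⟨i, hi⟩ := hx
  have (s : Finset (Fin n)) : ∑ j ∈ s, ψ j (x j) ≠ ⊥ := by
    induction s using Finset.cons_induction with
    | empty => simp
    | cons a s ha ih =>
      rw [Finset.sum_cons]
      simp [EReal.add_eq_bot_iff, (hψ a).ne_bot, ih]
  rw [objective, ← Finset.add_sum_erase _ _ (Finset.mem_univ i), hi,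
    EReal.top_add_of_ne_bot (this _), EReal.coe_add_top]

theorem mem_domain_of_isMin (hψ : ∀ i, IsClosedConvexFun (ψ i)) {xstar : Fin n → ℝ}
    (h : ∀ x, objective f ψ xstar ≤ objective f ψ x) : xstar ∈ domain ψ := by
  by_contra hx
  choose t ht using fun i => (hψ i).proper
  have := h t
  rw [objective_eq_top hψ hx, objective_eq_coe hψ (x := t) ht, top_le_iff] at this
  exact EReal.coe_ne_top _ this

theorem sum_partialDeriv_mul (x h : Fin n → ℝ) :
    ∑ i, partialDeriv f i x * h i = fderiv ℝ f x h := by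
  conv_rhs => rw [pi_eq_sum_univ' h, map_sum]
  refine Finset.sum_congr rfl fun i _ => ?_
  rw [map_smul, smul_eq_mul, mul_comm, partialDeriv]

theorem add_sum_partialDeriv_le (hd : Differentiable ℝ f) (hc : ConvexOn ℝ Set.univ f)
    (x y : Fin n → ℝ) : f y + ∑ i, partialDeriv f i y * (x i - y i) ≤ f x := by
  have h1 : ConvexOn ℝ Set.univ (f ∘ AffineMap.lineMap (k := ℝ) y x) :=
    hc.comp_affineMap (AffineMap.lineMap y x)
  have h2 : HasDerivAt (f ∘ AffineMap.lineMap (k := ℝ) y x) (fderiv ℝ f y (x - y)) 0 := by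
    have h3 : HasDerivAt (AffineMap.lineMap (k := ℝ) y x) (x - y) 0 :=
      AffineMap.hasDerivAt_lineMap
    refine HasFDerivAt.comp_hasDerivAt (0 : ℝ) ?_ h3
    rw [AffineMap.lineMap_apply_zero]
    exact (hd y).hasFDerivAt
  have h4 := h1.le_slope_of_hasDerivAt (Set.mem_univ 0) (Set.mem_univ 1) one_pos h2
  rw [slope_def_field] at h4
  simp only [Function.comp_apply, AffineMap.lineMap_apply_zero, AffineMap.lineMap_apply_one] at h4
  have h5 := sum_partialDeriv_mul (f := f) y (x - y)
  simp only [Pi.sub_apply] at h5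
  rw [h5]
  linarith

end Objective

/-! ### The coordinate update -/

section Update

variable {n : ℕ} {f : (Fin n → ℝ) → ℝ} {ψ : Fin n → ℝ → EReal} {v : Fin n → ℝ}

/-- The minimized function is a convex function plus `κ t²`, so at any `u` it exceeds its minimum by
at least `κ (u - t)²`. Existence of a minimizer is what gives the choice in `argmin` its meaning. -/
theorem coordUpdate_spec (hψ : ∀ i, IsClosedConvexFun (ψ i)) (hv : ∀ i, 0 < v i) {τ θ : ℝ}
    (hn : 0 < (n : ℝ)) (hτ : 0 < τ) (hθ : 0 < θ) (y z : Fin n → ℝ) (i : Fin n) :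
    ψ i (coordUpdate f ψ v τ θ y z i) ≠ ⊤ ∧ ∀ u, ψ i u ≠ ⊤ →
      partialDeriv f i y * (coordUpdate f ψ v τ θ y z i - y i) +
          θ * n * v i / (2 * τ) * (coordUpdate f ψ v τ θ y z i - z i) ^ 2 +
          (ψ i (coordUpdate f ψ v τ θ y z i)).toReal ≤
        partialDeriv f i y * (u - y i) + θ * n * v i / (2 * τ) * (u - z i) ^ 2 + (ψ i u).toReal -
          θ * n * v i / (2 * τ) * (u - coordUpdate f ψ v τ θ y z i) ^ 2 := by
  have hκ : 0 < θ * n * v i / (2 * τ) := by have := hv i; positivity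
  generalize hκ' : θ * n * v i / (2 * τ) = κ at hκ ⊢
  generalize hs : partialDeriv f i y = s
  obtain ⟨t₁, ht₁, hmin₁⟩ := (hψ i).exists_minimizer s (y i) (z i) κ hκ
  have hmin := Classical.epsilon_spec (p := fun t : ℝ => ∀ w : ℝ,
    ((s * (t - y i) + κ * |t - z i| ^ 2 : ℝ) : EReal) + ψ i t ≤
      ((s * (w - y i) + κ * |w - z i| ^ 2 : ℝ) : EReal) + ψ i w) ⟨t₁, hmin₁⟩
  have ht : coordUpdate f ψ v τ θ y z i = Classical.epsilon fun t : ℝ => ∀ w : ℝ,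
      ((s * (t - y i) + κ * |t - z i| ^ 2 : ℝ) : EReal) + ψ i t ≤
        ((s * (w - y i) + κ * |w - z i| ^ 2 : ℝ) : EReal) + ψ i w := by
    rw [coordUpdate, argmin, hκ', hs]
  rw [← ht] at hmin
  generalize coordUpdate f ψ v τ θ y z i = t at hmin
  simp only [sq_abs] at hmin
  have htop : ψ i t ≠ ⊤ := by
    intro htop
    have := hmin t₁
    rw [htop, EReal.coe_add_top, top_le_iff, ← EReal.coe_toReal ht₁ ((hψ i).ne_bot _),
      ← EReal.coe_add] at this
    exact EReal.coe_ne_top _ this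
  refine ⟨htop, fun u hu => ?_⟩
  have hreal : ∀ w, ψ i w ≠ ⊤ → s * (t - y i) + κ * (t - z i) ^ 2 + (ψ i t).toReal ≤
      s * (w - y i) + κ * (w - z i) ^ 2 + (ψ i w).toReal := by
    intro w hw
    have := hmin w
    rwa [← EReal.coe_toReal hw ((hψ i).ne_bot _), ← EReal.coe_toReal htop ((hψ i).ne_bot _),
      ← EReal.coe_add, ← EReal.coe_add, EReal.coe_le_coe_iff] at this
  -- Compare the minimizer with the point `(1 - a) t + a u` of the segment and divide by `a`.
  have hseg : ∀ a : ℝ, 0 < a → a ≤ 1 →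
      s * (t - y i) + κ * (t - z i) ^ 2 + (ψ i t).toReal ≤
        s * (u - y i) + κ * (u - z i) ^ 2 + (ψ i u).toReal - κ * (1 - a) * (u - t) ^ 2 := by
    intro a ha ha1
    have hconv := (hψ i).convexOn_toReal
    have h1 := hreal _ (hconv.1 htop hu (sub_nonneg.2 ha1) ha.le (by ring))
    have h2 := hconv.2 htop hu (sub_nonneg.2 ha1) ha.le (by ring)
    simp only [smul_eq_mul] at h1 h2
    refine le_of_mul_le_mul_left ?_ ha
    linear_combination h1 + h2
  -- Let `a → 0` in `hseg`: with `a = min 1 (ε / (c + 1))` the lost term `a c` is at most `ε`.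
  refine le_of_forall_pos_le_add fun ε hε => ?_
  set c := κ * (u - t) ^ 2 with hc
  have hc0 : 0 ≤ c := by positivity
  have := hseg (min 1 (ε / (c + 1))) (by positivity) (min_le_left _ _)
  have h3 : min 1 (ε / (c + 1)) * (c + 1) ≤ ε := by
    calc _ ≤ ε / (c + 1) * (c + 1) := by gcongr; exact min_le_right _ _
      _ = ε := by field_simp
  have h4 : 0 ≤ min 1 (ε / (c + 1)) := by positivity
  have h5 : κ * (1 - min 1 (ε / (c + 1))) * (u - t) ^ 2 = c - min 1 (ε / (c + 1)) * c := by
    rw [hc]; ring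
  linarith

end Update

/-! ### Uniform samplings -/

section Sampling

variable {n : ℕ} {p : PMF (Finset (Fin n))}

theorem sum_toReal_pmf {α : Type*} [Fintype α] (p : PMF α) : ∑ A, (p A).toReal = 1 := by
  have := p.tsum_coe
  rw [tsum_fintype] at this
  rw [← ENNReal.toReal_sum (fun a _ => p.apply_ne_top a), this, ENNReal.toReal_one]

theorem natCast_pos_of_tau_pos (hτ : 0 < tau p) : 0 < (n : ℝ) := by
  rcases Nat.eq_zero_or_pos n with rfl | h
  · simp [tau, Finset.eq_empty_of_isEmpty] at hτ
  · exact_mod_cast h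

theorem tau_div_pos (hτ : 0 < tau p) : 0 < tau p / n :=
  div_pos hτ (natCast_pos_of_tau_pos hτ)

theorem tau_div_le_one (hτ : 0 < tau p) : tau p / n ≤ 1 := by
  rw [div_le_one (natCast_pos_of_tau_pos hτ)]
  calc tau p ≤ ∑ A, (p A).toReal * (n : ℝ) := by
        refine Finset.sum_le_sum fun A _ => ?_
        gcongr
        simpa using Finset.card_le_univ A
    _ = n := by rw [← Finset.sum_mul, sum_toReal_pmf, one_mul]

/-- Double counting: the expected cardinality is the sum over coordinates of the inclusion
probabilities, which are all equal. -/
theorem IsUniformSampling.sum_mem (hp : IsUniformSampling p) (hτ : 0 < tau p) (i : Fin n) :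
    ∑ A with i ∈ A, (p A).toReal = tau p / n := by
  have hn := natCast_pos_of_tau_pos hτ
  have h1 (j : Fin n) :
      ∑ A with j ∈ A, (p A).toReal = ∑ A with i ∈ A, (p A).toReal := by
    rw [← ENNReal.toReal_sum (fun a _ => p.apply_ne_top a),
      ← ENNReal.toReal_sum (fun a _ => p.apply_ne_top a), hp j i]
  have h2 : tau p = ∑ j : Fin n, ∑ A with j ∈ A, (p A).toReal := by
    simp only [tau, Finset.sum_filter]
    rw [Finset.sum_comm]
    refine Finset.sum_congr rfl fun A _ => ?_
    rw [← Finset.sum_filter, Finset.sum_const, nsmul_eq_mul, mul_comm]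
    simp
  rw [eq_div_iff hn.ne', h2, Finset.sum_congr rfl fun j _ => h1 j]
  simp [mul_comm]

theorem IsUniformSampling.sum_separable (hp : IsUniformSampling p) (hτ : 0 < tau p)
    (φ : Fin n → ℝ → ℝ) (z w : Fin n → ℝ) :
    ∑ A, (p A).toReal * ∑ i, φ i (if i ∈ A then w i else z i) =
      (1 - tau p / n) * ∑ i, φ i (z i) + tau p / n * ∑ i, φ i (w i) := by
  simp only [Finset.mul_sum, ← Finset.sum_add_distrib]
  rw [Finset.sum_comm]
  refine Finset.sum_congr rfl fun i _ => ?_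
  have h1 : ∀ A : Finset (Fin n), (p A).toReal * φ i (if i ∈ A then w i else z i) =
      (p A).toReal * φ i (z i) + (if i ∈ A then (p A).toReal else 0) * (φ i (w i) - φ i (z i)) := by
    intro A
    split_ifs <;> ring
  simp only [h1, Finset.sum_add_distrib, ← Finset.sum_mul]
  rw [← Finset.sum_filter, hp.sum_mem hτ, sum_toReal_pmf]
  ring

theorem IsUniformSampling.mem_of_tau_div_eq_one (hp : IsUniformSampling p)
    (hτ : 0 < tau p) (h1 : tau p / n = 1) {A : Finset (Fin n)} (hA : p A ≠ 0) (i : Fin n) :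
    i ∈ A := by
  by_contra hi
  have h2 := hp.sum_mem hτ i
  have h3 := Finset.sum_filter_add_sum_filter_not Finset.univ (fun A => i ∈ A)
    (fun A => (p A).toReal)
  rw [sum_toReal_pmf, h2, h1] at h3
  have h4 : ∑ A with i ∉ A, (p A).toReal = 0 := by linarith
  rw [Finset.sum_eq_zero_iff_of_nonneg fun _ _ => ENNReal.toReal_nonneg] at h4
  exact (ENNReal.toReal_pos hA (p.apply_ne_top A)).ne' (h4 A (by simpa using hi))

end Sampling

/-! ### One iteration -/

/-- The intermediate point `y_k` of an iteration. -/
noncomputable def yPoint {n : ℕ} (τ : ℝ) (s : State n) : Fin n → ℝ :=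
  (1 - theta (τ / n) s.age) • s.x + theta (τ / n) s.age • s.z

section Step

variable {n : ℕ} {f : (Fin n → ℝ) → ℝ} {ψ : Fin n → ℝ → EReal} {v : Fin n → ℝ} {τ : ℝ}

@[simp] theorem approxStep_age (A : Finset (Fin n)) (s : State n) :
    (approxStep f ψ v τ A s).age = s.age + 1 := rfl

theorem approxStep_xs (A : Finset (Fin n)) (s : State n) :
    (approxStep f ψ v τ A s).xs =
      Function.update s.xs (s.age + 1) (approxStep f ψ v τ A s).x := by
  simp [approxStep, State.x]

theorem approxStep_z (A : Finset (Fin n)) (s : State n) (i : Fin n) :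
    (approxStep f ψ v τ A s).z i =
      if i ∈ A then coordUpdate f ψ v τ (theta (τ / n) s.age) (yPoint τ s) s.z i else s.z i := rfl

theorem approxStep_x (A : Finset (Fin n)) (s : State n) :
    (approxStep f ψ v τ A s).x =
      yPoint τ s + (n / τ * theta (τ / n) s.age) • ((approxStep f ψ v τ A s).z - s.z) := by
  simp [approxStep, State.x, yPoint]

/-- The number `Ψ` stands for the surrogate of `ψ(x)`, and it is updated by the same recursion as
`x`. Nothing is required of `s.x` or `s.z`: the terms in `separable ψ s.z` cancel in expectation, so
its value there is immaterial. -/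
theorem approx_step_expectation (hf_diff : Differentiable ℝ f) (hf_conv : ConvexOn ℝ Set.univ f)
    (hψ : ∀ i, IsClosedConvexFun (ψ i)) (hv : ∀ i, 0 < v i)
    {p : PMF (Finset (Fin n))} (hp : IsUniformSampling p) (hτ : 0 < tau p) (hESO : ESO f p v)
    {u : Fin n → ℝ} (hu : u ∈ domain ψ) (s : State n) (Ψ : ℝ) :
    ∑ A, (p A).toReal *
        (f (approxStep f ψ v (tau p) A s).x +
          ((1 - theta (tau p / n) s.age) * Ψ + theta (tau p / n) s.age * separable ψ s.z +
            theta (tau p / n) s.age / (tau p / n) *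
              (separable ψ (approxStep f ψ v (tau p) A s).z - separable ψ s.z)) -
          (f u + separable ψ u) +
          theta (tau p / n) s.age ^ 2 * (1 / (2 * (tau p / n) ^ 2) *
            wnormSq v ((approxStep f ψ v (tau p) A s).z - u))) ≤
      (1 - theta (tau p / n) s.age) * (f s.x + Ψ - (f u + separable ψ u)) +
        theta (tau p / n) s.age ^ 2 * (1 / (2 * (tau p / n) ^ 2) * wnormSq v (s.z - u)) := by
  have hn := natCast_pos_of_tau_pos hτ
  have hθ₀ := tau_div_pos hτ
  have hθ := theta_pos hθ₀ s.age
  have hθ1 := theta_le_one hθ₀ (tau_div_le_one hτ) s.age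
  set θ₀ := tau p / n with hθ₀def
  set θ := theta θ₀ s.age with hθdef
  set y := yPoint (tau p) s with hy
  set w : Fin n → ℝ := fun i => coordUpdate f ψ v (tau p) θ y s.z i with hw
  have hz (A : Finset (Fin n)) (i : Fin n) :
      (approxStep f ψ v (tau p) A s).z i = if i ∈ A then w i else s.z i := approxStep_z A s i
  have hratio : (n : ℝ) / tau p = 1 / θ₀ := by rw [hθ₀def, one_div_div]
  -- Only sampled coordinates move, so the new point has the form treated by the ESO inequality; its
  -- factor `θ₀` turns the step length `θ/θ₀` into `θ`.
  have hx (A : Finset (Fin n)) : (approxStep f ψ v (tau p) A s).x =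
      y + restrictTo A ((θ / θ₀) • (w - s.z)) := by
    rw [approxStep_x, hratio, one_div_mul_eq_div]
    congr 1
    ext i
    simp only [Pi.smul_apply, Pi.sub_apply, hz, restrictTo]
    split_ifs <;> simp [hθdef, hθ₀def]
  have hE1 : ∑ A, (p A).toReal * f (approxStep f ψ v (tau p) A s).x ≤
      f y + θ * (∑ i, partialDeriv f i y * (w i - s.z i) +
        θ / (2 * θ₀) * wnormSq v (w - s.z)) := by
    simp only [hx]
    refine (hESO y _).trans (le_of_eq ?_)
    rw [← hθ₀def]
    have h1 : ∑ i, partialDeriv f i y * ((θ / θ₀) • (w - s.z)) i =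
        θ / θ₀ * ∑ i, partialDeriv f i y * (w i - s.z i) := by
      rw [Finset.mul_sum]
      refine Finset.sum_congr rfl fun i _ => ?_
      simp only [Pi.smul_apply, Pi.sub_apply, smul_eq_mul]
      ring
    have h2 : wnormSq v ((θ / θ₀) • (w - s.z)) = (θ / θ₀) ^ 2 * wnormSq v (w - s.z) := by
      simp only [wnormSq]
      rw [Finset.mul_sum]
      refine Finset.sum_congr rfl fun i _ => ?_
      simp only [Pi.smul_apply, Pi.sub_apply, smul_eq_mul]
      ring
    rw [h1, h2]
    field_simp
  have hE2 : ∑ A, (p A).toReal * separable ψ (approxStep f ψ v (tau p) A s).z =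
      (1 - θ₀) * separable ψ s.z + θ₀ * separable ψ w := by
    simp only [separable, hz]
    exact hp.sum_separable hτ (fun i t => (ψ i t).toReal) s.z w
  have hE3 : ∑ A, (p A).toReal * wnormSq v ((approxStep f ψ v (tau p) A s).z - u) =
      (1 - θ₀) * wnormSq v (s.z - u) + θ₀ * wnormSq v (w - u) := by
    simp only [wnormSq, Pi.sub_apply, hz]
    exact hp.sum_separable hτ (fun i t => v i * (t - u i) ^ 2) s.z w
  have hprox : ∑ i, partialDeriv f i y * (w i - y i) + θ / (2 * θ₀) * wnormSq v (w - s.z) +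
        separable ψ w ≤
      ∑ i, partialDeriv f i y * (u i - y i) + θ / (2 * θ₀) * wnormSq v (s.z - u) +
        separable ψ u - θ / (2 * θ₀) * wnormSq v (w - u) := by
    simp only [wnormSq, separable, Finset.mul_sum, ← Finset.sum_add_distrib,
      ← Finset.sum_sub_distrib]
    refine Finset.sum_le_sum fun i _ => ?_
    have h1 := (coordUpdate_spec (f := f) hψ hv hn hτ hθ y s.z i).2 (u i) (hu i)
    have h2 : θ * n * v i / (2 * tau p) = θ / (2 * θ₀) * v i := by
      rw [hθ₀def]
      field_simp
    rw [h2] at h1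
    simp only [Pi.sub_apply]
    linear_combination h1
  have hgx := add_sum_partialDeriv_le hf_diff hf_conv s.x y
  have hgu := add_sum_partialDeriv_le hf_diff hf_conv u y
  -- By the definition of `y`, `θ (y - z) = (1 - θ) (x - y)`.
  have hsplit : θ * ∑ i, partialDeriv f i y * (w i - s.z i) =
      θ * ∑ i, partialDeriv f i y * (w i - y i) +
        (1 - θ) * ∑ i, partialDeriv f i y * (s.x i - y i) := by
    simp only [Finset.mul_sum, ← Finset.sum_add_distrib]
    refine Finset.sum_congr rfl fun i _ => ?_
    have : y i = (1 - θ) * s.x i + θ * s.z i := rfl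
    linear_combination partialDeriv f i y * this
  have hE : ∑ A, (p A).toReal *
        (f (approxStep f ψ v (tau p) A s).x +
          ((1 - θ) * Ψ + θ * separable ψ s.z +
            θ / θ₀ * (separable ψ (approxStep f ψ v (tau p) A s).z - separable ψ s.z)) -
          (f u + separable ψ u) +
          θ ^ 2 * (1 / (2 * θ₀ ^ 2) * wnormSq v ((approxStep f ψ v (tau p) A s).z - u))) =
      ∑ A, (p A).toReal * f (approxStep f ψ v (tau p) A s).x +
        ((1 - θ) * Ψ + θ * separable ψ w) - (f u + separable ψ u) +
        θ ^ 2 * (1 / (2 * θ₀ ^ 2) *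
          ((1 - θ₀) * wnormSq v (s.z - u) + θ₀ * wnormSq v (w - u))) := by
    have h1 : ∀ A, (p A).toReal *
        (f (approxStep f ψ v (tau p) A s).x +
          ((1 - θ) * Ψ + θ * separable ψ s.z +
            θ / θ₀ * (separable ψ (approxStep f ψ v (tau p) A s).z - separable ψ s.z)) -
          (f u + separable ψ u) +
          θ ^ 2 * (1 / (2 * θ₀ ^ 2) * wnormSq v ((approxStep f ψ v (tau p) A s).z - u))) =
        (p A).toReal * f (approxStep f ψ v (tau p) A s).x +
          θ / θ₀ * ((p A).toReal * separable ψ (approxStep f ψ v (tau p) A s).z) +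
          θ ^ 2 * (1 / (2 * θ₀ ^ 2)) *
            ((p A).toReal * wnormSq v ((approxStep f ψ v (tau p) A s).z - u)) +
          (p A).toReal * ((1 - θ) * Ψ + θ * separable ψ s.z - θ / θ₀ * separable ψ s.z -
            (f u + separable ψ u)) := fun A => by ring
    simp only [h1, Finset.sum_add_distrib, ← Finset.mul_sum, ← Finset.sum_mul, hE2, hE3,
      sum_toReal_pmf]
    field_simp
    ring
  rw [hE]
  have hθ₀ne := hθ₀.ne'
  have h4 : θ ^ 2 * (1 / (2 * θ₀ ^ 2) *
        ((1 - θ₀) * wnormSq v (s.z - u) + θ₀ * wnormSq v (w - u))) =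
      θ ^ 2 * (1 / (2 * θ₀ ^ 2) * wnormSq v (s.z - u)) -
        θ * (θ / (2 * θ₀) * wnormSq v (s.z - u)) + θ * (θ / (2 * θ₀) * wnormSq v (w - u)) := by
    field_simp
  rw [h4]
  have h5 := mul_le_mul_of_nonneg_left hprox hθ.le
  have h6 := mul_le_mul_of_nonneg_left hgx (sub_nonneg.2 hθ1)
  have h7 := mul_le_mul_of_nonneg_left hgu hθ.le
  linarith

end Step

/-! ### Objective gap and Lyapunov function as real numbers -/

/-- `F(x) - F(xstar)` as a real number (meaningful on the domain). -/
noncomputable def gap {n : ℕ} (f : (Fin n → ℝ) → ℝ) (ψ : Fin n → ℝ → EReal)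
    (xstar x : Fin n → ℝ) : ℝ :=
  f x + separable ψ x - (f xstar + separable ψ xstar)

/-- The Lyapunov function as a real number (meaningful on the domain, or if `θ₀ = 1`). -/
noncomputable def realDelta {n : ℕ} (f : (Fin n → ℝ) → ℝ) (ψ : Fin n → ℝ → EReal)
    (v : Fin n → ℝ) (θ₀ : ℝ) (xstar x : Fin n → ℝ) : ℝ :=
  (1 - θ₀) / θ₀ ^ 2 * gap f ψ xstar x + 1 / (2 * θ₀ ^ 2) * wnormSq v (x - xstar)

section Gap

variable {n : ℕ} {f : (Fin n → ℝ) → ℝ} {ψ : Fin n → ℝ → EReal} {v xstar : Fin n → ℝ}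

theorem wnormSq_nonneg (hv : ∀ i, 0 < v i) (x : Fin n → ℝ) : 0 ≤ wnormSq v x :=
  Finset.sum_nonneg fun i _ => mul_nonneg (hv i).le (sq_nonneg _)

theorem convexOn_wnormSq_sub (hv : ∀ i, 0 < v i) (u : Fin n → ℝ) :
    ConvexOn ℝ Set.univ fun x => wnormSq v (x - u) := by
  refine ⟨convex_univ, fun x _ y _ a b ha hb hab => ?_⟩
  simp only [wnormSq, smul_eq_mul, Finset.mul_sum, ← Finset.sum_add_distrib]
  refine Finset.sum_le_sum fun i _ => ?_
  have h : a * (v i * (x - u) i ^ 2) + b * (v i * (y - u) i ^ 2) -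
      v i * (a • x + b • y - u) i ^ 2 = v i * (a * b * (x i - y i) ^ 2) := by
    simp only [Pi.sub_apply, Pi.add_apply, Pi.smul_apply, smul_eq_mul]
    obtain rfl : b = 1 - a := by linarith
    ring
  have := mul_nonneg (hv i).le (mul_nonneg (mul_nonneg ha hb) (sq_nonneg (x i - y i)))
  linarith

theorem convexOn_gap (hf_conv : ConvexOn ℝ Set.univ f) (hψ : ∀ i, IsClosedConvexFun (ψ i)) :
    ConvexOn ℝ (domain ψ) (gap f ψ xstar) := by
  have h := convexOn_separable hψ
  have h1 : gap f ψ xstar = f + separable ψ + fun _ => -(f xstar + separable ψ xstar) := by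
    ext x
    simp only [gap, Pi.add_apply, sub_eq_add_neg]
  rw [h1]
  exact ((hf_conv.subset (Set.subset_univ _) h.1).add h).add (convexOn_const _ h.1)

theorem gap_nonneg (hψ : ∀ i, IsClosedConvexFun (ψ i))
    (hxstar : ∀ x, objective f ψ xstar ≤ objective f ψ x) {x : Fin n → ℝ} (hx : x ∈ domain ψ) :
    0 ≤ gap f ψ xstar x := by
  have := hxstar x
  rw [objective_eq_coe hψ hx, objective_eq_coe hψ (mem_domain_of_isMin hψ hxstar),
    EReal.coe_le_coe_iff] at this
  exact sub_nonneg.2 this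

theorem StrongConvexityAt.le_gap {μ : ℝ} (hF : StrongConvexityAt f ψ v xstar μ)
    (hψ : ∀ i, IsClosedConvexFun (ψ i)) (hstar : xstar ∈ domain ψ) {x : Fin n → ℝ}
    (hx : x ∈ domain ψ) : μ / 2 * wnormSq v (x - xstar) ≤ gap f ψ xstar x := by
  have := hF x
  rw [objective_eq_coe hψ hx, objective_eq_coe hψ hstar, ← EReal.coe_add,
    EReal.coe_le_coe_iff] at this
  exact le_sub_iff_add_le'.2 this

theorem convexOn_realDelta (hf_conv : ConvexOn ℝ Set.univ f)
    (hψ : ∀ i, IsClosedConvexFun (ψ i)) (hv : ∀ i, 0 < v i) {θ₀ : ℝ} (h1 : θ₀ ≤ 1) :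
    ConvexOn ℝ (domain ψ) (realDelta f ψ v θ₀ xstar) := by
  have h := convexOn_gap (xstar := xstar) hf_conv hψ
  exact (h.smul (div_nonneg (sub_nonneg.2 h1) (sq_nonneg _))).add
    (((convexOn_wnormSq_sub hv xstar).subset (Set.subset_univ _) h.1).smul (by positivity))

theorem realDelta_nonneg (hψ : ∀ i, IsClosedConvexFun (ψ i)) (hv : ∀ i, 0 < v i)
    (hxstar : ∀ x, objective f ψ xstar ≤ objective f ψ x) {θ₀ : ℝ} (h1 : θ₀ ≤ 1) {x : Fin n → ℝ}
    (hx : x ∈ domain ψ ∨ θ₀ = 1) : 0 ≤ realDelta f ψ v θ₀ xstar x := by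
  refine add_nonneg ?_ (mul_nonneg (by positivity) (wnormSq_nonneg hv _))
  rcases hx with hx | rfl
  · exact mul_nonneg (div_nonneg (sub_nonneg.2 h1) (sq_nonneg _)) (gap_nonneg hψ hxstar hx)
  · simp

/-- Strong convexity bounds the norm term of `Δ` by the gap, giving `μ θ₀² Δ ≤ (1 + μ (1 - θ₀)) ·
gap`; this is the origin of the constant in `mCoeff`. -/
theorem StrongConvexityAt.mCoeff_mul_realDelta_le {μ θ₀ : ℝ} (hF : StrongConvexityAt f ψ v xstar μ)
    (hψ : ∀ i, IsClosedConvexFun (ψ i)) (hstar : xstar ∈ domain ψ) (hμ : 0 < μ) (h0 : 0 < θ₀)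
    (h1 : θ₀ ≤ 1) (k : ℕ) {x : Fin n → ℝ} (hx : x ∈ domain ψ) :
    mCoeff θ₀ k μ * realDelta f ψ v θ₀ xstar x ≤ totalWeight θ₀ k * gap f ψ xstar x := by
  have h2 := hF.le_gap hψ hstar hx
  have h3 : 0 < 1 + μ * (1 - θ₀) := by
    have := mul_nonneg hμ.le (sub_nonneg.2 h1)
    linarith
  have h4 : μ * θ₀ ^ 2 * realDelta f ψ v θ₀ xstar x ≤ (1 + μ * (1 - θ₀)) * gap f ψ xstar x := by
    have : μ * θ₀ ^ 2 * realDelta f ψ v θ₀ xstar x =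
        μ * (1 - θ₀) * gap f ψ xstar x + μ / 2 * wnormSq v (x - xstar) := by
      unfold realDelta
      field_simp
    linarith
  calc mCoeff θ₀ k μ * realDelta f ψ v θ₀ xstar x
      = totalWeight θ₀ k * (μ * θ₀ ^ 2 * realDelta f ψ v θ₀ xstar x / (1 + μ * (1 - θ₀))) := by
        unfold mCoeff
        ring
    _ ≤ totalWeight θ₀ k * gap f ψ xstar x := by
        refine mul_le_mul_of_nonneg_left ?_ (totalWeight_pos h0 h1 k).le
        rw [div_le_iff₀ h3]
        linarith

theorem Delta_eq_ofReal (hψ : ∀ i, IsClosedConvexFun (ψ i)) (hv : ∀ i, 0 < v i)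
    (hxstar : ∀ x, objective f ψ xstar ≤ objective f ψ x) {θ₀ : ℝ} (h1 : θ₀ ≤ 1) {x : Fin n → ℝ}
    (hx : x ∈ domain ψ ∨ θ₀ = 1) :
    Delta f ψ v θ₀ xstar x = ENNReal.ofReal (realDelta f ψ v θ₀ xstar x) := by
  have hw : 0 ≤ 1 / (2 * θ₀ ^ 2) * wnormSq v (x - xstar) :=
    mul_nonneg (by positivity) (wnormSq_nonneg hv _)
  by_cases h : θ₀ = 1
  · simp [Delta, realDelta, h]
  have hx := hx.resolve_right h
  have hc : 0 ≤ (1 - θ₀) / θ₀ ^ 2 := div_nonneg (sub_nonneg.2 h1) (sq_nonneg _)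
  have hg := gap_nonneg hψ hxstar hx
  rw [Delta, realDelta, objective_eq_coe hψ hx, objective_eq_coe hψ (mem_domain_of_isMin hψ hxstar),
    ← EReal.coe_sub, EReal.toENNReal_of_ne_top (EReal.coe_ne_top _), EReal.toReal_coe,
    ← ENNReal.ofReal_mul hc, ENNReal.ofReal_add (mul_nonneg hc hg) hw, gap]

theorem Delta_eq_top (hψ : ∀ i, IsClosedConvexFun (ψ i))
    (hxstar : ∀ x, objective f ψ xstar ≤ objective f ψ x) {θ₀ : ℝ} (h0 : 0 < θ₀) (h1 : θ₀ ≤ 1)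
    {x : Fin n → ℝ} (hx : ¬ (x ∈ domain ψ ∨ θ₀ = 1)) : Delta f ψ v θ₀ xstar x = ⊤ := by
  rw [not_or] at hx
  have hlt : 0 < 1 - θ₀ := sub_pos.2 (lt_of_le_of_ne h1 hx.2)
  rw [Delta, objective_eq_top hψ hx.1, objective_eq_coe hψ (mem_domain_of_isMin hψ hxstar),
    EReal.top_sub_coe, EReal.toENNReal_top, ENNReal.mul_top, top_add]
  simpa using by positivity

end Gap

/-! ### A run without restart -/

/-- The states of a run of APPROX started at `a` and driven by `T 0, T 1, …`. -/
noncomputable def run {n : ℕ} (f : (Fin n → ℝ) → ℝ) (ψ : Fin n → ℝ → EReal) (v : Fin n → ℝ)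
    (τ : ℝ) (a : Fin n → ℝ) (T : ℕ → Finset (Fin n)) : ℕ → State n
  | 0 => State.start a
  | k + 1 => approxStep f ψ v τ (T k) (run f ψ v τ a T k)

/-- The average `∑ i ≤ k, γ_k^i ψ(z_i)`, an upper bound for `ψ(x_k)`. -/
noncomputable def runSeparable {n : ℕ} (f : (Fin n → ℝ) → ℝ) (ψ : Fin n → ℝ → EReal)
    (v : Fin n → ℝ) (τ : ℝ) (a : Fin n → ℝ) (T : ℕ → Finset (Fin n)) (k : ℕ) : ℝ :=
  ∑ i ∈ Finset.range (k + 1), gamma (τ / n) k i • separable ψ (run f ψ v τ a T i).z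

/-- The potential that decreases in expectation along a run. -/
noncomputable def potential {n : ℕ} (f : (Fin n → ℝ) → ℝ) (ψ : Fin n → ℝ → EReal)
    (v : Fin n → ℝ) (τ : ℝ) (u a : Fin n → ℝ) (T : ℕ → Finset (Fin n)) (k : ℕ) : ℝ :=
  invSq (τ / n) k *
      (f (run f ψ v τ a T k).x + runSeparable f ψ v τ a T k - (f u + separable ψ u)) +
    1 / (2 * (τ / n) ^ 2) * wnormSq v ((run f ψ v τ a T k).z - u)

section Run

variable {n : ℕ} {f : (Fin n → ℝ) → ℝ} {ψ : Fin n → ℝ → EReal} {v : Fin n → ℝ} {τ : ℝ}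
  {a : Fin n → ℝ} {T : ℕ → Finset (Fin n)}

@[simp] theorem run_age : ∀ k, (run f ψ v τ a T k).age = k
  | 0 => rfl
  | k + 1 => by rw [run, approxStep_age, run_age k]

theorem run_xs {k i : ℕ} (h : i ≤ k) :
    (run f ψ v τ a T k).xs i = (run f ψ v τ a T i).x := by
  induction k with
  | zero =>
    obtain rfl : i = 0 := by omega
    rfl
  | succ k ih =>
    rcases h.eq_or_lt with rfl | h
    · rw [State.x, run_age]
    · rw [run, approxStep_xs, run_age, Function.update_of_ne (by omega), ih (by omega)]

theorem run_congr {T' : ℕ → Finset (Fin n)} {k : ℕ} (h : ∀ i < k, T i = T' i) :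
    run f ψ v τ a T k = run f ψ v τ a T' k := by
  induction k with
  | zero => rfl
  | succ k ih => rw [run, run, ih fun i hi => h i (by omega), h k (by omega)]

theorem run_x_eq (hτ : 0 < τ / n) (k : ℕ) :
    (run f ψ v τ a T k).x =
      ∑ i ∈ Finset.range (k + 1), gamma (τ / n) k i • (run f ψ v τ a T i).z := by
  induction k with
  | zero => simp [run, gamma, State.start, State.x]
  | succ k ih =>
    rw [sum_gamma_smul_succ hτ, ← ih]
    conv_lhs => rw [run, approxStep_x, yPoint, run_age]
    rw [run, div_eq_inv_mul _ (τ / n), inv_div]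

theorem runSeparable_succ (hτ : 0 < τ / n) (k : ℕ) :
    runSeparable f ψ v τ a T (k + 1) =
      (1 - theta (τ / n) k) * runSeparable f ψ v τ a T k +
        theta (τ / n) k * separable ψ (run f ψ v τ a T k).z +
        theta (τ / n) k / (τ / n) *
          (separable ψ (run f ψ v τ a T (k + 1)).z - separable ψ (run f ψ v τ a T k).z) :=
  sum_gamma_smul_succ hτ (fun i => separable ψ (run f ψ v τ a T i).z) k

theorem runSeparable_congr {T' : ℕ → Finset (Fin n)} {k : ℕ} (h : ∀ i < k, T i = T' i) :
    runSeparable f ψ v τ a T k = runSeparable f ψ v τ a T' k := by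
  refine Finset.sum_congr rfl fun i hi => ?_
  rw [run_congr fun j hj => h j (by have := Finset.mem_range.1 hi; omega)]

theorem potential_congr {T' : ℕ → Finset (Fin n)} {k : ℕ} (u : Fin n → ℝ)
    (h : ∀ i < k, T i = T' i) : potential f ψ v τ u a T k = potential f ψ v τ u a T' k := by
  rw [potential, potential, run_congr h, runSeparable_congr h]

theorem potential_zero (u : Fin n → ℝ) :
    potential f ψ v τ u a T 0 = realDelta f ψ v (τ / n) u a := by
  simp [potential, realDelta, gap, invSq, runSeparable, run, gamma, State.start, State.x]

/-- Overwriting entry `k` of the sample sequence and summing over its values plays the role of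
conditional expectation given the first `k` samples. -/
theorem sum_potential_succ_le (hf_diff : Differentiable ℝ f) (hf_conv : ConvexOn ℝ Set.univ f)
    (hψ : ∀ i, IsClosedConvexFun (ψ i)) (hv : ∀ i, 0 < v i)
    {p : PMF (Finset (Fin n))} (hp : IsUniformSampling p) (hτ : 0 < tau p) (hESO : ESO f p v)
    {u : Fin n → ℝ} (hu : u ∈ domain ψ) (k : ℕ) :
    ∑ A, (p A).toReal * potential f ψ v (tau p) u a (Function.update T k A) (k + 1) ≤
      potential f ψ v (tau p) u a T k := by
  have hθ₀ := tau_div_pos hτ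
  have hθ := theta_pos hθ₀ k
  have h := approx_step_expectation hf_diff hf_conv hψ hv hp hτ hESO hu
    (run f ψ v (tau p) a T k) (runSeparable f ψ v (tau p) a T k)
  rw [run_age] at h
  have hcongr (A : Finset (Fin n)) : ∀ i < k, Function.update T k A i = T i := fun i hi =>
    Function.update_of_ne hi.ne _ _
  have hrun (A : Finset (Fin n)) : run f ψ v (tau p) a (Function.update T k A) (k + 1) =
      approxStep f ψ v (tau p) A (run f ψ v (tau p) a T k) := by
    rw [run, run_congr (hcongr A), Function.update_self]
  simp only [potential, runSeparable_succ hθ₀, hrun, run_congr (hcongr _),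
    runSeparable_congr (hcongr _), invSq_eq hθ₀ k]
  refine le_of_mul_le_mul_left ?_ (pow_pos hθ 2)
  rw [Finset.mul_sum]
  have hcancel : ∀ c b d : ℝ, theta (tau p / n) k ^ 2 * (c / theta (tau p / n) k ^ 2 * b + d) =
      c * b + theta (tau p / n) k ^ 2 * d := fun c b d => by field_simp
  refine (le_of_eq ?_).trans (h.trans (le_of_eq (hcancel _ _ _).symm))
  refine Finset.sum_congr rfl fun A _ => ?_
  rw [mul_left_comm, show invSq (tau p / n) (k + 1) = 1 / theta (tau p / n) k ^ 2 from rfl,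
    hcancel, one_mul]

/-- A refreshed coordinate always has finite `ψ i`. The others keep their value, which is finite if
`a` is in the domain; if `θ₀ = 1` there are no others. -/
theorem run_z_mem_domain (hψ : ∀ i, IsClosedConvexFun (ψ i)) (hv : ∀ i, 0 < v i)
    {p : PMF (Finset (Fin n))} (hp : IsUniformSampling p) (hτ : 0 < tau p)
    (hT : ∀ k, p (T k) ≠ 0) (ha : a ∈ domain ψ ∨ tau p / n = 1) (k : ℕ) :
    (run f ψ v (tau p) a T (k + 1)).z ∈ domain ψ := by
  have hn := natCast_pos_of_tau_pos hτ
  have hspec (s : State n) (i : Fin n) :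
      ψ i (coordUpdate f ψ v (tau p) (theta (tau p / n) s.age) (yPoint (tau p) s) s.z i) ≠ ⊤ :=
    (coordUpdate_spec hψ hv hn hτ (theta_pos (tau_div_pos hτ) _) _ _ i).1
  rcases ha with ha | h1
  · have hall : ∀ j, (run f ψ v (tau p) a T j).z ∈ domain ψ := by
      intro j
      induction j with
      | zero => exact ha
      | succ j ih =>
        intro i
        rw [run, approxStep_z]
        split_ifs
        · exact hspec _ i
        · exact ih i
    exact hall _
  · intro i
    rw [run, approxStep_z, if_pos (hp.mem_of_tau_div_eq_one hτ h1 (hT k) i)]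
    exact hspec _ i

theorem run_x_mem_domain (hψ : ∀ i, IsClosedConvexFun (ψ i)) (hτ : 0 < τ / n)
    (hz : ∀ k, (run f ψ v τ a T (k + 1)).z ∈ domain ψ) (k : ℕ) :
    (run f ψ v τ a T (k + 1)).x ∈ domain ψ ∧
      separable ψ (run f ψ v τ a T (k + 1)).x ≤ runSeparable f ψ v τ a T (k + 1) := by
  have hconv := convexOn_separable hψ
  have hsum : ∑ i ∈ Finset.Icc 1 (k + 1), gamma (τ / n) (k + 1) i = 1 := by
    have := sum_gamma_Icc (τ / n) k (fun _ => (1 : ℝ))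
    simp only [smul_eq_mul, mul_one] at this
    rw [this, sum_gamma hτ]
  have hmem : ∀ i ∈ Finset.Icc 1 (k + 1), (run f ψ v τ a T i).z ∈ domain ψ := by
    intro i hi
    obtain ⟨j, rfl⟩ := Nat.exists_eq_add_of_le' (Finset.mem_Icc.1 hi).1
    exact hz j
  rw [run_x_eq hτ, runSeparable, ← sum_gamma_Icc, ← sum_gamma_Icc]
  exact ⟨hconv.1.sum_mem (fun i _ => gamma_nonneg hτ _ _) hsum hmem,
    hconv.map_sum_le (fun i _ => gamma_nonneg hτ _ _) hsum hmem⟩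

theorem ringPoint_run (k : ℕ) :
    ringPoint (τ / n) (run f ψ v τ a T (k + 1)).xs (k + 1) =
      ∑ i ∈ Finset.Icc 1 (k + 1), ringWeight (τ / n) (k + 1) i • (run f ψ v τ a T i).x := by
  rw [ringPoint_eq]
  refine Finset.sum_congr rfl fun i hi => ?_
  rw [run_xs (Finset.mem_Icc.1 hi).2]

/-! ### Pathwise convexity estimates for the averaged points of a run -/

section Averages

variable (hf_conv : ConvexOn ℝ Set.univ f) (hψ : ∀ i, IsClosedConvexFun (ψ i))
  (hv : ∀ i, 0 < v i) (hτ : 0 < τ / n) (hτ1 : τ / n ≤ 1)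
  (hz : ∀ k, (run f ψ v τ a T (k + 1)).z ∈ domain ψ)
include hf_conv hψ hv hτ hτ1 hz

theorem realDelta_run_add_le {μ : ℝ} (hμ : 0 < μ) {xstar : Fin n → ℝ}
    (hF : StrongConvexityAt f ψ v xstar μ) (hstar : xstar ∈ domain ψ) (k : ℕ) :
    realDelta f ψ v (τ / n) xstar (run f ψ v τ a T (k + 1)).x +
        mCoeff (τ / n) (k + 1) μ * realDelta f ψ v (τ / n) xstar
          (ringPoint (τ / n) (run f ψ v τ a T (k + 1)).xs (k + 1)) ≤
      ∑ i ∈ Finset.Icc 1 (k + 1),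
        gamma (τ / n) (k + 1) i * potential f ψ v τ xstar a T i := by
  have hx : ∀ i ∈ Finset.Icc 1 (k + 1), (run f ψ v τ a T i).x ∈ domain ψ ∧
      separable ψ (run f ψ v τ a T i).x ≤ runSeparable f ψ v τ a T i := by
    intro i hi
    obtain ⟨j, rfl⟩ := Nat.exists_eq_add_of_le' (Finset.mem_Icc.1 hi).1
    exact run_x_mem_domain hψ hτ hz j
  have hw : ∀ i ∈ Finset.Icc 1 (k + 1), 0 ≤ ringWeight (τ / n) (k + 1) i :=
    fun i _ => ringWeight_nonneg hτ hτ1 _ _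
  have hw1 := sum_ringWeight hτ hτ1 k
  have hring : ringPoint (τ / n) (run f ψ v τ a T (k + 1)).xs (k + 1) ∈ domain ψ := by
    rw [ringPoint_run]
    exact (convexOn_separable hψ).1.sum_mem hw hw1 fun i hi => (hx i hi).1
  have h1 := hF.mCoeff_mul_realDelta_le hψ hstar hμ hτ hτ1 (k + 1) hring
  have h2 : gap f ψ xstar (ringPoint (τ / n) (run f ψ v τ a T (k + 1)).xs (k + 1)) ≤
      ∑ i ∈ Finset.Icc 1 (k + 1),
        ringWeight (τ / n) (k + 1) i • gap f ψ xstar (run f ψ v τ a T i).x := by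
    rw [ringPoint_run]
    exact (convexOn_gap hf_conv hψ).map_sum_le hw hw1 fun i hi => (hx i hi).1
  -- The gap weights of the averaged potentials are those of the ring point, except that the last
  -- one exceeds its counterpart by `(1 - θ₀)/θ₀²`, exactly the coefficient in `Δ(x_{k+1})`.
  have h3 : totalWeight (τ / n) (k + 1) * ∑ i ∈ Finset.Icc 1 (k + 1),
        ringWeight (τ / n) (k + 1) i • gap f ψ xstar (run f ψ v τ a T i).x =
      ∑ i ∈ Finset.Icc 1 (k + 1), gamma (τ / n) (k + 1) i *
          (invSq (τ / n) i * gap f ψ xstar (run f ψ v τ a T i).x) -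
        (1 - τ / n) / (τ / n) ^ 2 * gap f ψ xstar (run f ψ v τ a T (k + 1)).x := by
    have hs := sum_gamma_Icc (τ / n) k
      (fun i => invSq (τ / n) i * gap f ψ xstar (run f ψ v τ a T i).x)
    simp only [smul_eq_mul] at hs
    rw [sum_ringWeight_smul, hs, Finset.sum_range_succ _ (k + 1), smul_eq_mul,
      ← mul_assoc, mul_one_div_cancel (totalWeight_pos hτ hτ1 (k + 1)).ne', one_mul,
      lastWeight_eq hτ]
    simp only [smul_eq_mul, mul_assoc]
    ring
  have h4 : wnormSq v ((run f ψ v τ a T (k + 1)).x - xstar) ≤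
      ∑ i ∈ Finset.Icc 1 (k + 1),
        gamma (τ / n) (k + 1) i • wnormSq v ((run f ψ v τ a T i).z - xstar) := by
    rw [sum_gamma_Icc, run_x_eq hτ]
    exact (convexOn_wnormSq_sub hv xstar).map_sum_le (fun i _ => gamma_nonneg hτ _ _)
      (sum_gamma hτ (k + 1)) fun _ _ => Set.mem_univ _
  have h5 : ∑ i ∈ Finset.Icc 1 (k + 1), gamma (τ / n) (k + 1) i *
          (invSq (τ / n) i * gap f ψ xstar (run f ψ v τ a T i).x) +
        1 / (2 * (τ / n) ^ 2) * ∑ i ∈ Finset.Icc 1 (k + 1),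
          gamma (τ / n) (k + 1) i • wnormSq v ((run f ψ v τ a T i).z - xstar) ≤
      ∑ i ∈ Finset.Icc 1 (k + 1),
        gamma (τ / n) (k + 1) i * potential f ψ v τ xstar a T i := by
    rw [Finset.mul_sum, ← Finset.sum_add_distrib]
    refine Finset.sum_le_sum fun i hi => ?_
    have h6 : gap f ψ xstar (run f ψ v τ a T i).x ≤ f (run f ψ v τ a T i).x +
        runSeparable f ψ v τ a T i - (f xstar + separable ψ xstar) := by
      have := (hx i hi).2
      unfold gap
      linarith
    have h7 := mul_le_mul_of_nonneg_left
      (mul_le_mul_of_nonneg_left h6 (invSq_nonneg hτ hτ1 i)) (gamma_nonneg hτ (k + 1) i)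
    simp only [potential, smul_eq_mul]
    linarith
  have h8 := mul_le_mul_of_nonneg_left h2 (totalWeight_pos hτ hτ1 (k + 1)).le
  have h9 := mul_le_mul_of_nonneg_left h4 (show 0 ≤ 1 / (2 * (τ / n) ^ 2) by positivity)
  have h10 : realDelta f ψ v (τ / n) xstar (run f ψ v τ a T (k + 1)).x =
    (1 - τ / n) / (τ / n) ^ 2 * gap f ψ xstar (run f ψ v τ a T (k + 1)).x +
      1 / (2 * (τ / n) ^ 2) * wnormSq v ((run f ψ v τ a T (k + 1)).x - xstar) := rfl
  linarith

theorem realDelta_ringPoint_run_le (xstar : Fin n → ℝ) (k : ℕ) :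
    ringPoint (τ / n) (run f ψ v τ a T (k + 1)).xs (k + 1) ∈ domain ψ ∧
      realDelta f ψ v (τ / n) xstar
          (ringPoint (τ / n) (run f ψ v τ a T (k + 1)).xs (k + 1)) ≤
        ∑ i ∈ Finset.Icc 1 (k + 1), ringWeight (τ / n) (k + 1) i *
          realDelta f ψ v (τ / n) xstar (run f ψ v τ a T i).x := by
  have hx : ∀ i ∈ Finset.Icc 1 (k + 1), (run f ψ v τ a T i).x ∈ domain ψ := by
    intro i hi
    obtain ⟨j, rfl⟩ := Nat.exists_eq_add_of_le' (Finset.mem_Icc.1 hi).1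
    exact (run_x_mem_domain hψ hτ hz j).1
  have hw : ∀ i ∈ Finset.Icc 1 (k + 1), 0 ≤ ringWeight (τ / n) (k + 1) i :=
    fun i _ => ringWeight_nonneg hτ hτ1 _ _
  have hconv := convexOn_realDelta (xstar := xstar) hf_conv hψ hv hτ1
  rw [ringPoint_run]
  exact ⟨hconv.1.sum_mem hw (sum_ringWeight hτ hτ1 k) hx,
    hconv.map_sum_le hw (sum_ringWeight hτ hτ1 k) hx⟩

theorem realDelta_barPoint_run_le {σ : ℝ} (hσ : σ ∈ Set.Ioo (0 : ℝ) 1) (xstar : Fin n → ℝ)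
    (k : ℕ) :
    barPoint (τ / n) σ (run f ψ v τ a T (k + 1)).xs (k + 1) ∈ domain ψ ∧
      realDelta f ψ v (τ / n) xstar
          (barPoint (τ / n) σ (run f ψ v τ a T (k + 1)).xs (k + 1)) ≤
        σ * realDelta f ψ v (τ / n) xstar (run f ψ v τ a T (k + 1)).x +
          (1 - σ) * realDelta f ψ v (τ / n) xstar
            (ringPoint (τ / n) (run f ψ v τ a T (k + 1)).xs (k + 1)) := by
  have hconv := convexOn_realDelta (xstar := xstar) hf_conv hψ hv hτ1
  have h1 := (run_x_mem_domain hψ hτ hz k).1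
  have h2 := (realDelta_ringPoint_run_le hf_conv hψ hv hτ hτ1 hz xstar k).1
  have h3 := sub_nonneg.2 hσ.2.le
  rw [barPoint, run_xs le_rfl]
  exact ⟨hconv.1 h1 h2 hσ.1.le h3 (by ring), hconv.2 h1 h2 hσ.1.le h3 (by ring)⟩

end Averages

end Run

/-! ### Expectations of functions of finitely many samples -/

section Sampling

variable {n : ℕ} {p : PMF (Finset (Fin n))} {Ω : Type*} [MeasurableSpace Ω] {P : Measure Ω}
  [IsProbabilityMeasure P] {S : ℕ → Ω → Finset (Fin n)}

theorem exists_factor_of_dependsOn {α β : Type*} [Inhabited α] {G : (ℕ → α) → β} {k : ℕ}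
    (hG : DependsOn G (Set.Iio k)) :
    ∃ g : (Finset.range k → α) → β, ∀ T, G T = g fun i => T i := by
  refine ⟨fun w => G fun t => if h : t ∈ Finset.range k then w ⟨t, h⟩ else default, fun T => ?_⟩
  refine hG fun t ht => ?_
  rw [dif_pos (Finset.mem_range.2 ht)]

/-- Such a function factors through finitely many samples with finitely many values, so no bound or
measurability of the update map is needed. -/
theorem integrable_of_dependsOn (hS_meas : ∀ k, Measurable[_, ⊤] (S k))
    {G : (ℕ → Finset (Fin n)) → ℝ} {k : ℕ} (hG : DependsOn G (Set.Iio k)) :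
    Integrable (fun ω => G fun t => S t ω) P := by
  let _ : MeasurableSpace (Finset (Fin n)) := ⊤
  obtain ⟨g, hg⟩ := exists_factor_of_dependsOn hG
  have hW : Measurable fun ω (i : Finset.range k) => S i ω :=
    measurable_pi_lambda _ fun i => hS_meas i
  have := Measure.isProbabilityMeasure_map (μ := P) hW.aemeasurable
  simp only [hg]
  exact (Integrable.of_finite (μ := P.map fun ω (i : Finset.range k) => S i ω)
    (f := g)).comp_measurable hW

/-- Split according to the value `A` of `S k`. Once entry `k` is frozen at `A`, the integrand
depends only on earlier samples, hence is independent of the event `S k = A`. -/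
theorem integral_eq_integral_sum_update (hS_meas : ∀ k, Measurable[_, ⊤] (S k))
    (hS_indep : iIndepFun (m := fun _ => ⊤) S P) (hS_law : ∀ k A, P (S k ⁻¹' {A}) = p A)
    {G : (ℕ → Finset (Fin n)) → ℝ} {k : ℕ} (hG : DependsOn G (Set.Iio (k + 1))) :
    ∫ ω, G (fun t => S t ω) ∂P =
      ∫ ω, ∑ A, (p A).toReal * G (Function.update (fun t => S t ω) k A) ∂P := by
  have hdep (A : Finset (Fin n)) :
      DependsOn (fun T => G (Function.update T k A)) (Set.Iio k) := by
    intro T T' hT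
    refine hG fun i hi => ?_
    rcases eq_or_ne i k with rfl | hne
    · simp
    · rw [Function.update_of_ne hne, Function.update_of_ne hne]
      exact hT i (lt_of_le_of_ne (Nat.lt_succ_iff.1 hi) hne)
  let _ : MeasurableSpace (Finset (Fin n)) := ⊤
  have hset (A : Finset (Fin n)) : MeasurableSet (S k ⁻¹' {A}) := hS_meas k trivial
  have hint (A : Finset (Fin n)) := integrable_of_dependsOn (P := P) hS_meas (hdep A)
  have hmul (A : Finset (Fin n)) :
      ∫ ω, (S k ⁻¹' {A}).indicator 1 ω * G (Function.update (fun t => S t ω) k A) ∂P =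
        (p A).toReal * ∫ ω, G (Function.update (fun t => S t ω) k A) ∂P := by
    obtain ⟨g, hg⟩ := exists_factor_of_dependsOn (hdep A)
    have hind := hS_indep.indepFun_finset {k} (Finset.range k) (by simp) hS_meas
    have hcomp := hind.comp
      (φ := fun w => if w ⟨k, Finset.mem_singleton_self k⟩ = A then (1 : ℝ) else 0) (ψ := g)
      (measurable_of_countable _) (measurable_of_countable _)
    have h1 : (fun ω => (S k ⁻¹' {A}).indicator (1 : Ω → ℝ) ω) =
        (fun w : ({k} : Finset ℕ) → Finset (Fin n) =>
          if w ⟨k, Finset.mem_singleton_self k⟩ = A then (1 : ℝ) else 0) ∘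
          fun ω (i : ({k} : Finset ℕ)) => S i ω := by
      ext ω
      by_cases h : S k ω = A
      · simp [h]
      · simp [h]
    have h2 : (fun ω => G (Function.update (fun t => S t ω) k A)) =
        g ∘ fun ω (i : Finset.range k) => S i ω := by
      ext ω
      exact hg _
    rw [← h1, ← h2] at hcomp
    rw [hcomp.integral_fun_mul_eq_mul_integral
      ((measurable_one.indicator (hset A)).aestronglyMeasurable) (hint A).aestronglyMeasurable,
      integral_indicator_one (hset A), Measure.real, hS_law]
  have hsplit (ω : Ω) : G (fun t => S t ω) =
      ∑ A, (S k ⁻¹' {A}).indicator 1 ω * G (Function.update (fun t => S t ω) k A) := by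
    rw [Finset.sum_eq_single_of_mem (S k ω) (Finset.mem_univ _)]
    · rw [Set.indicator_of_mem (by simp), Pi.one_apply, one_mul]
      congr 1
      exact (Function.update_eq_self k (fun t => S t ω)).symm
    · intro A _ hA
      rw [Set.indicator_of_notMem (by simpa using hA.symm), zero_mul]
  simp_rw [hsplit]
  rw [integral_finsetSum _ fun A _ => ?_, integral_finsetSum _ fun A _ => (hint A).const_mul _]
  · refine Finset.sum_congr rfl fun A _ => ?_
    rw [hmul, integral_const_mul]
  · have : (fun ω => (S k ⁻¹' {A}).indicator (1 : Ω → ℝ) ω *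
        G (Function.update (fun t => S t ω) k A)) =
        (S k ⁻¹' {A}).indicator fun ω => G (Function.update (fun t => S t ω) k A) := by
      ext ω
      by_cases h : ω ∈ S k ⁻¹' {A} <;> simp [h]
    rw [this]
    exact (hint A).indicator (hset A)

omit [IsProbabilityMeasure P] in
theorem ae_sample_ne_zero (hS_law : ∀ k A, P (S k ⁻¹' {A}) = p A) :
    ∀ᵐ ω ∂P, ∀ k, p (S k ω) ≠ 0 := by
  refine ae_all_iff.2 fun k => ?_
  have : ∀ᵐ ω ∂P, ∀ A ∈ (Finset.univ.filter fun A => p A = 0), S k ω ≠ A := by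
    refine (Finset.eventually_all _).2 fun A hA => ?_
    rw [ae_iff]
    simp only [not_not]
    exact (hS_law k A).trans (Finset.mem_filter.1 hA).2
  filter_upwards [this] with ω hω h
  exact hω (S k ω) (by simpa using h) rfl

end Sampling

/-! ### Expected decrease along a run started at a random point -/

section RandomRun

variable {n : ℕ} {f : (Fin n → ℝ) → ℝ} {ψ : Fin n → ℝ → EReal} {v : Fin n → ℝ} {τ : ℝ}

theorem dependsOn_run {β : Type*} {t₀ k : ℕ} {a : (ℕ → Finset (Fin n)) → Fin n → ℝ}
    (ha : DependsOn a (Set.Iio t₀)) (g : State n → β) :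
    DependsOn (fun T => g (run f ψ v τ (a T) (fun j => T (t₀ + j)) k)) (Set.Iio (t₀ + k)) := by
  intro T T' hT
  have h1 : a T = a T' := ha fun i hi => hT i (lt_of_lt_of_le hi (Nat.le_add_right _ _))
  simp only [h1]
  rw [run_congr fun i hi => hT (t₀ + i) (Nat.add_lt_add_left hi t₀)]

theorem dependsOn_potential {t₀ k : ℕ} {a : (ℕ → Finset (Fin n)) → Fin n → ℝ}
    (ha : DependsOn a (Set.Iio t₀)) (u : Fin n → ℝ) :
    DependsOn (fun T => potential f ψ v τ u (a T) (fun j => T (t₀ + j)) k)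
      (Set.Iio (t₀ + k)) := by
  intro T T' hT
  have h1 : a T = a T' := ha fun i hi => hT i (lt_of_lt_of_le hi (Nat.le_add_right _ _))
  simp only [h1]
  exact potential_congr u fun i hi => hT (t₀ + i) (Nat.add_lt_add_left hi t₀)

variable (hf_diff : Differentiable ℝ f) (hf_conv : ConvexOn ℝ Set.univ f)
  (hψ : ∀ i, IsClosedConvexFun (ψ i)) {xstar : Fin n → ℝ}
  (hxstar : ∀ x, objective f ψ xstar ≤ objective f ψ x) (hv : ∀ i, 0 < v i)
  {p : PMF (Finset (Fin n))} (hp : IsUniformSampling p) (hτ : 0 < tau p) (hESO : ESO f p v)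
  {Ω : Type*} [MeasurableSpace Ω] {P : Measure Ω} [IsProbabilityMeasure P]
  {S : ℕ → Ω → Finset (Fin n)} (hS_meas : ∀ k, Measurable[_, ⊤] (S k))
  (hS_indep : iIndepFun (m := fun _ => ⊤) S P) (hS_law : ∀ k A, P (S k ⁻¹' {A}) = p A)
  {t₀ : ℕ} {a : (ℕ → Finset (Fin n)) → Fin n → ℝ} (ha : DependsOn a (Set.Iio t₀))

include hf_diff hf_conv hψ hxstar hv hp hτ hESO hS_meas hS_indep hS_law ha in
-- Each induction step integrates out the sample `t₀ + k`. The random start `a` is unaffected, as it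
-- depends only on samples before `t₀`.
theorem integral_potential_le (k : ℕ) :
    ∫ ω, potential f ψ v (tau p) xstar (a fun t => S t ω) (fun j => S (t₀ + j) ω) k ∂P ≤
      ∫ ω, realDelta f ψ v (tau p / n) xstar (a fun t => S t ω) ∂P := by
  induction k with
  | zero => simp only [potential_zero, le_refl]
  | succ k ih =>
    refine le_trans ?_ ih
    have hstep := integral_eq_integral_sum_update hS_meas hS_indep hS_law (k := t₀ + k)
      (dependsOn_potential (f := f) (ψ := ψ) (v := v) (τ := tau p) (k := k + 1) ha xstar)
    rw [hstep]
    have hshift (T : ℕ → Finset (Fin n)) (A : Finset (Fin n)) :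
        (fun j => Function.update T (t₀ + k) A (t₀ + j)) =
          Function.update (fun j => T (t₀ + j)) k A := by
      ext1 j
      simp [Function.update_apply]
    have haT (T : ℕ → Finset (Fin n)) (A : Finset (Fin n)) :
        a (Function.update T (t₀ + k) A) = a T :=
      ha fun i hi => Function.update_of_ne (by have : i < t₀ := hi; omega) _ _
    simp only [hshift, haT]
    refine integral_mono ?_ (integrable_of_dependsOn hS_meas (dependsOn_potential ha xstar)) fun ω =>
      sum_potential_succ_le hf_diff hf_conv hψ hv hp hτ hESO (mem_domain_of_isMin hψ hxstar) k
    refine integrable_finsetSum _ fun A _ => Integrable.const_mul ?_ _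
    refine integrable_of_dependsOn hS_meas (k := t₀ + k) (G := fun T =>
      potential f ψ v (tau p) xstar (a T) (Function.update (fun j => T (t₀ + j)) k A) (k + 1))
      fun T T' hT => ?_
    have h1 : a T = a T' := ha fun i hi => hT i (lt_of_lt_of_le hi (Nat.le_add_right _ _))
    simp only [h1]
    refine potential_congr xstar fun i hi => ?_
    simp only [Function.update_apply]
    split_ifs with h
    · rfl
    · exact hT _ (show t₀ + i < t₀ + k by omega)

variable (hgood : ∀ᵐ ω ∂P, (a fun t => S t ω) ∈ domain ψ ∨ tau p / n = 1)

omit [IsProbabilityMeasure P] in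
include hψ hv hp hτ hS_law hgood in
theorem ae_run_z_mem_domain :
    ∀ᵐ ω ∂P, ∀ k,
      (run f ψ v (tau p) (a fun t => S t ω) (fun j => S (t₀ + j) ω) (k + 1)).z ∈ domain ψ := by
  filter_upwards [hgood, ae_sample_ne_zero hS_law] with ω h1 h2 k
  exact run_z_mem_domain hψ hv hp hτ (fun j => h2 (t₀ + j)) h1 k

omit [IsProbabilityMeasure P] in
include hψ hv hp hτ hS_law hgood in
theorem ae_run_x_mem_domain (k : ℕ) :
    ∀ᵐ ω ∂P, (run f ψ v (tau p) (a fun t => S t ω) (fun j => S (t₀ + j) ω) k).x ∈ domain ψ ∨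
      tau p / n = 1 := by
  cases k with
  | zero => exact hgood
  | succ k =>
    filter_upwards [ae_run_z_mem_domain hψ hv hp hτ hS_law hgood] with ω h
    exact Or.inl (run_x_mem_domain hψ (tau_div_pos hτ) h k).1

omit [IsProbabilityMeasure P] in
include hf_conv hψ hv hp hτ hS_law hgood in
theorem ae_barPoint_mem_domain {σ : ℝ} (hσ : σ ∈ Set.Ioo (0 : ℝ) 1) (k : ℕ) :
    ∀ᵐ ω ∂P, barPoint (tau p / n) σ (run f ψ v (tau p) (a fun t => S t ω)
      (fun j => S (t₀ + j) ω) (k + 1)).xs (k + 1) ∈ domain ψ := by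
  filter_upwards [ae_run_z_mem_domain hψ hv hp hτ hS_law hgood] with ω h
  exact (realDelta_barPoint_run_le hf_conv hψ hv (tau_div_pos hτ) (tau_div_le_one hτ) h hσ 0 k).1

/-! ### Expected decrease of the Lyapunov function over one run -/

section Decrease

variable {μ : ℝ} (hμ : 0 < μ) (hF : StrongConvexityAt f ψ v xstar μ)
include hf_diff hf_conv hψ hxstar hv hp hτ hESO hS_meas hS_indep hS_law ha hgood hμ hF

theorem integral_realDelta_run_add_le (k : ℕ) :
    ∫ ω, realDelta f ψ v (tau p / n) xstar
        (run f ψ v (tau p) (a fun t => S t ω) (fun j => S (t₀ + j) ω) (k + 1)).x ∂P +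
      mCoeff (tau p / n) (k + 1) μ * ∫ ω, realDelta f ψ v (tau p / n) xstar
        (ringPoint (tau p / n) (run f ψ v (tau p) (a fun t => S t ω)
          (fun j => S (t₀ + j) ω) (k + 1)).xs (k + 1)) ∂P ≤
    ∫ ω, realDelta f ψ v (tau p / n) xstar (a fun t => S t ω) ∂P := by
  have hθ := tau_div_pos hτ
  have hθ1 := tau_div_le_one hτ
  have hi1 := integrable_of_dependsOn (P := P) hS_meas (dependsOn_run (f := f) (ψ := ψ) (v := v)
    (τ := tau p) (k := k + 1) ha fun s => realDelta f ψ v (tau p / n) xstar s.x)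
  have hi2 := integrable_of_dependsOn (P := P) hS_meas (dependsOn_run (f := f) (ψ := ψ) (v := v)
    (τ := tau p) (k := k + 1) ha fun s =>
      realDelta f ψ v (tau p / n) xstar (ringPoint (tau p / n) s.xs (k + 1)))
  have hi3 (i : ℕ) := integrable_of_dependsOn (P := P) hS_meas (dependsOn_potential (f := f)
    (ψ := ψ) (v := v) (τ := tau p) (k := i) ha xstar)
  have hsum : ∑ i ∈ Finset.Icc 1 (k + 1), gamma (tau p / n) (k + 1) i = 1 := by
    have := sum_gamma_Icc (tau p / n) k (fun _ => (1 : ℝ))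
    simp only [smul_eq_mul, mul_one] at this
    rw [this, sum_gamma hθ]
  rw [← integral_const_mul, ← integral_add hi1 (hi2.const_mul _)]
  calc _ ≤ ∫ ω, ∑ i ∈ Finset.Icc 1 (k + 1), gamma (tau p / n) (k + 1) i *
        potential f ψ v (tau p) xstar (a fun t => S t ω) (fun j => S (t₀ + j) ω) i ∂P := by
        refine integral_mono_ae (hi1.add (hi2.const_mul _))
          (integrable_finsetSum _ fun i _ => (hi3 i).const_mul _) ?_
        filter_upwards [ae_run_z_mem_domain hψ hv hp hτ hS_law hgood] with ω h
        exact realDelta_run_add_le hf_conv hψ hv hθ hθ1 h hμ hF (mem_domain_of_isMin hψ hxstar) k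
    _ = ∑ i ∈ Finset.Icc 1 (k + 1), gamma (tau p / n) (k + 1) i *
        ∫ ω, potential f ψ v (tau p) xstar (a fun t => S t ω) (fun j => S (t₀ + j) ω) i ∂P := by
        rw [integral_finsetSum _ fun i _ => (hi3 i).const_mul _]
        simp only [integral_const_mul]
    _ ≤ ∑ i ∈ Finset.Icc 1 (k + 1), gamma (tau p / n) (k + 1) i *
        ∫ ω, realDelta f ψ v (tau p / n) xstar (a fun t => S t ω) ∂P := by
        refine Finset.sum_le_sum fun i _ => mul_le_mul_of_nonneg_left ?_ (gamma_nonneg hθ _ _)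
        exact integral_potential_le hf_diff hf_conv hψ hxstar hv hp hτ hESO hS_meas hS_indep
          hS_law ha i
    _ = _ := by rw [← Finset.sum_mul, hsum, one_mul]

theorem integral_realDelta_run_le (k : ℕ) :
    ∫ ω, realDelta f ψ v (tau p / n) xstar
        (run f ψ v (tau p) (a fun t => S t ω) (fun j => S (t₀ + j) ω) k).x ∂P ≤
    ∫ ω, realDelta f ψ v (tau p / n) xstar (a fun t => S t ω) ∂P := by
  cases k with
  | zero => exact le_rfl
  | succ k =>
    have hθ := tau_div_pos hτ
    have hθ1 := tau_div_le_one hτ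
    refine le_trans (le_add_of_nonneg_right (mul_nonneg (mCoeff_pos hθ hθ1 hμ (k + 1)).le
      (integral_nonneg_of_ae ?_))) (integral_realDelta_run_add_le hf_diff hf_conv hψ hxstar hv hp
        hτ hESO hS_meas hS_indep hS_law ha hgood hμ hF k)
    filter_upwards [ae_run_z_mem_domain hψ hv hp hτ hS_law hgood] with ω h
    exact realDelta_nonneg hψ hv hxstar hθ1
      (Or.inl (realDelta_ringPoint_run_le hf_conv hψ hv hθ hθ1 h xstar k).1)

theorem integral_realDelta_ringPoint_le (k : ℕ) :
    ∫ ω, realDelta f ψ v (tau p / n) xstar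
        (ringPoint (tau p / n) (run f ψ v (tau p) (a fun t => S t ω)
          (fun j => S (t₀ + j) ω) (k + 1)).xs (k + 1)) ∂P ≤
    ∫ ω, realDelta f ψ v (tau p / n) xstar (a fun t => S t ω) ∂P := by
  have hθ := tau_div_pos hτ
  have hθ1 := tau_div_le_one hτ
  have hi1 (i : ℕ) := integrable_of_dependsOn (P := P) hS_meas (dependsOn_run (f := f) (ψ := ψ)
    (v := v) (τ := tau p) (k := i) ha fun s => realDelta f ψ v (tau p / n) xstar s.x)
  have hi2 := integrable_of_dependsOn (P := P) hS_meas (dependsOn_run (f := f) (ψ := ψ) (v := v)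
    (τ := tau p) (k := k + 1) ha fun s =>
      realDelta f ψ v (tau p / n) xstar (ringPoint (tau p / n) s.xs (k + 1)))
  calc _ ≤ ∫ ω, ∑ i ∈ Finset.Icc 1 (k + 1), ringWeight (tau p / n) (k + 1) i *
        realDelta f ψ v (tau p / n) xstar
          (run f ψ v (tau p) (a fun t => S t ω) (fun j => S (t₀ + j) ω) i).x ∂P := by
        refine integral_mono_ae hi2 (integrable_finsetSum _ fun i _ => (hi1 i).const_mul _) ?_
        filter_upwards [ae_run_z_mem_domain hψ hv hp hτ hS_law hgood] with ω h
        exact (realDelta_ringPoint_run_le hf_conv hψ hv hθ hθ1 h xstar k).2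
    _ = ∑ i ∈ Finset.Icc 1 (k + 1), ringWeight (tau p / n) (k + 1) i *
        ∫ ω, realDelta f ψ v (tau p / n) xstar
          (run f ψ v (tau p) (a fun t => S t ω) (fun j => S (t₀ + j) ω) i).x ∂P := by
        rw [integral_finsetSum _ fun i _ => (hi1 i).const_mul _]
        simp only [integral_const_mul]
    _ ≤ ∑ i ∈ Finset.Icc 1 (k + 1), ringWeight (tau p / n) (k + 1) i *
        ∫ ω, realDelta f ψ v (tau p / n) xstar (a fun t => S t ω) ∂P := by
        refine Finset.sum_le_sum fun i _ =>
          mul_le_mul_of_nonneg_left ?_ (ringWeight_nonneg hθ hθ1 _ _)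
        exact integral_realDelta_run_le hf_diff hf_conv hψ hxstar hv hp hτ hESO hS_meas hS_indep
          hS_law ha hgood hμ hF i
    _ = _ := by rw [← Finset.sum_mul, sum_ringWeight hθ hθ1, one_mul]

theorem integral_realDelta_barPoint_le {σ : ℝ} (hσ : σ ∈ Set.Ioo (0 : ℝ) 1) (k : ℕ) :
    ∫ ω, realDelta f ψ v (tau p / n) xstar
        (barPoint (tau p / n) σ (run f ψ v (tau p) (a fun t => S t ω)
          (fun j => S (t₀ + j) ω) (k + 1)).xs (k + 1)) ∂P ≤
    max σ (1 - σ * mCoeff (tau p / n) (k + 1) μ) *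
      ∫ ω, realDelta f ψ v (tau p / n) xstar (a fun t => S t ω) ∂P := by
  have hθ := tau_div_pos hτ
  have hθ1 := tau_div_le_one hτ
  have hi1 := integrable_of_dependsOn (P := P) hS_meas (dependsOn_run (f := f) (ψ := ψ) (v := v)
    (τ := tau p) (k := k + 1) ha fun s => realDelta f ψ v (tau p / n) xstar s.x)
  have hi2 := integrable_of_dependsOn (P := P) hS_meas (dependsOn_run (f := f) (ψ := ψ) (v := v)
    (τ := tau p) (k := k + 1) ha fun s =>
      realDelta f ψ v (tau p / n) xstar (ringPoint (tau p / n) s.xs (k + 1)))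
  have hi3 := integrable_of_dependsOn (P := P) hS_meas (dependsOn_run (f := f) (ψ := ψ) (v := v)
    (τ := tau p) (k := k + 1) ha fun s =>
      realDelta f ψ v (tau p / n) xstar (barPoint (tau p / n) σ s.xs (k + 1)))
  have hx := integral_realDelta_run_add_le hf_diff hf_conv hψ hxstar hv hp hτ hESO hS_meas
    hS_indep hS_law ha hgood hμ hF k
  have hr := integral_realDelta_ringPoint_le hf_diff hf_conv hψ hxstar hv hp hτ hESO hS_meas
    hS_indep hS_law ha hgood hμ hF k
  have hr0 : 0 ≤ ∫ ω, realDelta f ψ v (tau p / n) xstar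
      (ringPoint (tau p / n) (run f ψ v (tau p) (a fun t => S t ω)
        (fun j => S (t₀ + j) ω) (k + 1)).xs (k + 1)) ∂P := by
    refine integral_nonneg_of_ae ?_
    filter_upwards [ae_run_z_mem_domain hψ hv hp hτ hS_law hgood] with ω h
    exact realDelta_nonneg hψ hv hxstar hθ1
      (Or.inl (realDelta_ringPoint_run_le hf_conv hψ hv hθ hθ1 h xstar k).1)
  have hbar : ∫ ω, realDelta f ψ v (tau p / n) xstar
        (barPoint (tau p / n) σ (run f ψ v (tau p) (a fun t => S t ω)
          (fun j => S (t₀ + j) ω) (k + 1)).xs (k + 1)) ∂P ≤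
      σ * ∫ ω, realDelta f ψ v (tau p / n) xstar
        (run f ψ v (tau p) (a fun t => S t ω) (fun j => S (t₀ + j) ω) (k + 1)).x ∂P +
      (1 - σ) * ∫ ω, realDelta f ψ v (tau p / n) xstar
        (ringPoint (tau p / n) (run f ψ v (tau p) (a fun t => S t ω)
          (fun j => S (t₀ + j) ω) (k + 1)).xs (k + 1)) ∂P := by
    rw [← integral_const_mul, ← integral_const_mul,
      ← integral_add (hi1.const_mul _) (hi2.const_mul _)]
    refine integral_mono_ae hi3 ((hi1.const_mul _).add (hi2.const_mul _)) ?_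
    filter_upwards [ae_run_z_mem_domain hψ hv hp hτ hS_law hgood] with ω h
    exact (realDelta_barPoint_run_le hf_conv hψ hv hθ hθ1 h hσ xstar k).2
  generalize (∫ ω, realDelta f ψ v (tau p / n) xstar (a fun t => S t ω) ∂P) = D at *
  generalize (∫ ω, realDelta f ψ v (tau p / n) xstar
        (ringPoint (tau p / n) (run f ψ v (tau p) (a fun t => S t ω)
          (fun j => S (t₀ + j) ω) (k + 1)).xs (k + 1)) ∂P) = R at *
  generalize (∫ ω, realDelta f ψ v (tau p / n) xstar
        (run f ψ v (tau p) (a fun t => S t ω) (fun j => S (t₀ + j) ω) (k + 1)).x ∂P) = X at *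
  generalize mCoeff (tau p / n) (k + 1) μ = m at *
  refine hbar.trans ?_
  have h1 := mul_le_mul_of_nonneg_left hx hσ.1.le
  -- The bound is now `σ D + (1 - σ - σ m) R` with `0 ≤ R ≤ D`. It is linear in `R`, so the extreme
  -- values `R = 0` and `R = D` give the two entries of the maximum.
  rcases le_total (1 - σ - σ * m) 0 with hm | hm
  · have h2 := mul_le_mul_of_nonneg_right (le_max_left σ (1 - σ * m)) (hr0.trans hr)
    have h3 := mul_nonneg (neg_nonneg.2 hm) hr0
    linarith
  · have h2 := mul_le_mul_of_nonneg_right (le_max_right σ (1 - σ * m)) (hr0.trans hr)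
    have h3 := mul_le_mul_of_nonneg_left hr hm
    linarith

end Decrease

end RandomRun

/-! ### Restarts -/

section Restart

variable {n : ℕ} {f : (Fin n → ℝ) → ℝ} {ψ : Fin n → ℝ → EReal} {v : Fin n → ℝ} {τ σ : ℝ}
  {K e : ℕ} {x₀ : Fin n → ℝ}

theorem dependsOn_restartedApprox (k : ℕ) :
    DependsOn (fun T => restartedApprox f ψ v τ σ K e x₀ T k) (Set.Iio k) := by
  induction k with
  | zero => exact fun _ _ _ => rfl
  | succ k ih =>
    intro T T' hT
    have h1 : restartedApprox f ψ v τ σ K e x₀ T k = restartedApprox f ψ v τ σ K e x₀ T' k :=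
      ih fun i hi => hT i (Nat.lt_succ_of_lt hi)
    have h2 : T k = T' k := hT k (Nat.lt_succ_self k)
    simp only [restartedApprox, h1, h2]

theorem restartedApprox_succ_of_eq_run {T : ℕ → Finset (Fin n)} {a : Fin n → ℝ} {t₀ k : ℕ}
    (h : restartedApprox f ψ v τ σ K e x₀ T (t₀ + k) =
      run f ψ v τ a (fun j => T (t₀ + j)) k) :
    restartedApprox f ψ v τ σ K e x₀ T (t₀ + (k + 1)) =
      if (t₀ + k + e) % K = 0 then
        State.start (barPoint (τ / n) σ (run f ψ v τ a (fun j => T (t₀ + j)) (k + 1)).xs (k + 1))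
      else run f ψ v τ a (fun j => T (t₀ + j)) (k + 1) := by
  have h1 : run f ψ v τ a (fun j => T (t₀ + j)) (k + 1) =
      approxStep f ψ v τ (T (t₀ + k)) (run f ψ v τ a (fun j => T (t₀ + j)) k) := rfl
  rw [← add_assoc, restartedApprox, h, ← h1, run_age]

variable (hf_diff : Differentiable ℝ f) (hf_conv : ConvexOn ℝ Set.univ f)
  (hψ : ∀ i, IsClosedConvexFun (ψ i)) {xstar : Fin n → ℝ}
  (hxstar : ∀ x, objective f ψ xstar ≤ objective f ψ x) (hv : ∀ i, 0 < v i)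
  {μ : ℝ} (hμ : 0 < μ) (hF : StrongConvexityAt f ψ v xstar μ)
  {p : PMF (Finset (Fin n))} (hp : IsUniformSampling p) (hτ : 0 < tau p) (hESO : ESO f p v)
  {Ω : Type*} [MeasurableSpace Ω] {P : Measure Ω} [IsProbabilityMeasure P]
  {S : ℕ → Ω → Finset (Fin n)} (hS_meas : ∀ k, Measurable[_, ⊤] (S k))
  (hS_indep : iIndepFun (m := fun _ => ⊤) S P) (hS_law : ∀ k A, P (S k ⁻¹' {A}) = p A)
  (hx₀ : x₀ ∈ domain ψ ∨ tau p / n = 1) (hσ : σ ∈ Set.Ioo (0 : ℝ) 1) (hK : 1 ≤ K)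
  (he : e = 0 ∨ e = 1)
include hf_diff hf_conv hψ hxstar hv hμ hF hp hτ hESO hS_meas hS_indep hS_law hx₀ hσ hK he

/-- Here `t₀` is the latest restart (or the start), `j` counts the complete runs of length `K`, and
`r` is the age of the current run. The truncated difference `1 - e` is the first regular starting
index: `1` if iteration `0` already restarts, else `0`. -/
theorem exists_last_restart (k : ℕ) :
    ∃ t₀ j r : ℕ, 1 - e + k = t₀ + r ∧ t₀ = j * K + (1 - e) ∧ r < K ∧
      (∀ T, restartedApprox f ψ v (tau p) σ K e x₀ T (t₀ + r) =
        run f ψ v (tau p) (restartedApprox f ψ v (tau p) σ K e x₀ T t₀).x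
          (fun j => T (t₀ + j)) r) ∧
      (∀ᵐ ω ∂P, (restartedApprox f ψ v (tau p) σ K e x₀ (fun t => S t ω) t₀).x ∈ domain ψ ∨
        tau p / n = 1) ∧
      ∫ ω, realDelta f ψ v (tau p / n) xstar
          (restartedApprox f ψ v (tau p) σ K e x₀ (fun t => S t ω) t₀).x ∂P ≤
        max σ (1 - σ * mCoeff (tau p / n) K μ) ^ j * realDelta f ψ v (tau p / n) xstar x₀ := by
  have hθ := tau_div_pos hτ
  have hθ1 := tau_div_le_one hτ
  have hdep (t₀ : ℕ) : DependsOn (fun T => (restartedApprox f ψ v (tau p) σ K e x₀ T t₀).x)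
      (Set.Iio t₀) := fun T T' hT => congrArg State.x (dependsOn_restartedApprox t₀ hT)
  induction k with
  | zero =>
    rcases he with rfl | rfl
    · have hrun (T : ℕ → Finset (Fin n)) := restartedApprox_succ_of_eq_run (f := f) (ψ := ψ)
        (v := v) (τ := tau p) (σ := σ) (K := K) (e := 0) (x₀ := x₀) (a := x₀) (T := T) (t₀ := 0)
        (k := 0) rfl
      simp only [Nat.zero_add, Nat.add_zero, Nat.zero_mod, if_true] at hrun
      have hgood : ∀ᵐ _ ∂P, x₀ ∈ domain ψ ∨ tau p / n = 1 := .of_forall fun _ => hx₀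
      have hbar := ae_barPoint_mem_domain (t₀ := 0) (a := fun _ => x₀) hf_conv hψ hv hp hτ hS_law
        hgood hσ 0
      have hint := integral_realDelta_barPoint_le (t₀ := 0) (a := fun _ => x₀) hf_diff hf_conv hψ
        hxstar hv hp hτ hESO hS_meas hS_indep hS_law (fun _ _ _ => rfl) hgood hμ hF hσ 0
      refine ⟨1, 0, 0, rfl, by simp, hK, fun T => ?_, ?_, ?_⟩
      · simp only [Nat.add_zero, hrun, run]
        rfl
      · filter_upwards [hbar] with ω hω
        left
        rw [hrun]
        simp only [Nat.zero_add] at hω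
        exact hω
      · simp only [hrun]
        simp only [Nat.zero_add, integral_const, probReal_univ, one_smul] at hint
        rw [pow_zero, one_mul]
        -- The initial run of length one may have the wrong factor `1 - σ m_1`, so it is only used
        -- as nonexpansive.
        refine hint.trans (mul_le_of_le_one_left (realDelta_nonneg hψ hv hxstar hθ1 hx₀) ?_)
        have := mul_pos hσ.1 (mCoeff_pos hθ hθ1 hμ 1)
        exact max_le hσ.2.le (by linarith)
    · refine ⟨0, 0, 0, rfl, by simp, hK, fun T => rfl, .of_forall fun _ => hx₀, ?_⟩
      simp [restartedApprox, State.start, State.x]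
  | succ k ih =>
    obtain ⟨t₀, j, r, hk, ht₀, hr, hrun, hgood, hint⟩ := ih
    have hnext (T : ℕ → Finset (Fin n)) := restartedApprox_succ_of_eq_run (hrun T)
    by_cases hrK : r + 1 = K
    · have hmod : (t₀ + r + e) % K = 0 := by
        have : t₀ + r + e = (j + 1) * K := by
          rw [ht₀, ← hrK]
          rcases he with rfl | rfl <;> ring
        rw [this, Nat.mul_mod_left]
      simp only [hmod, if_true] at hnext
      refine ⟨t₀ + (r + 1), j + 1, 0, by omega, by rw [ht₀, ← hrK]; ring, hK, fun T => ?_, ?_, ?_⟩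
      · simp only [Nat.add_zero, hnext, run]
        rfl
      · filter_upwards [ae_barPoint_mem_domain (a := fun T =>
          (restartedApprox f ψ v (tau p) σ K e x₀ T t₀).x) hf_conv hψ hv hp hτ hS_law hgood hσ r]
          with ω hω
        left
        rw [hnext]
        exact hω
      · have h1 := integral_realDelta_barPoint_le hf_diff hf_conv hψ hxstar hv hp hτ hESO hS_meas
          hS_indep hS_law (hdep t₀) hgood hμ hF hσ r
        rw [hrK] at h1
        simp only [hnext]
        simp only [hrK]
        refine h1.trans ?_
        rw [pow_succ', mul_assoc]
        exact mul_le_mul_of_nonneg_left hint (hσ.1.le.trans (le_max_left _ _))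
    · have hmod : (t₀ + r + e) % K ≠ 0 := by
        have : t₀ + r + e = r + 1 + K * j := by
          rw [ht₀]
          rcases he with rfl | rfl <;> ring
        rw [this, Nat.add_mul_mod_self_left, Nat.mod_eq_of_lt (by omega)]
        omega
      exact ⟨t₀, j, r + 1, by omega, ht₀, by omega,
        fun T => by rw [hnext, if_neg hmod], hgood, hint⟩

theorem lintegral_Delta_le (k : ℕ) :
    ∃ j r : ℕ, 1 - e + k = j * K + (1 - e) + r ∧ r < K ∧
      ∫⁻ ω, Delta f ψ v (tau p / n) xstar
          (restartedApprox f ψ v (tau p) σ K e x₀ (fun t => S t ω) (1 - e + k)).x ∂P ≤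
        ENNReal.ofReal (max σ (1 - σ * mCoeff (tau p / n) K μ) ^ j) *
          Delta f ψ v (tau p / n) xstar x₀ := by
  have hθ1 := tau_div_le_one hτ
  obtain ⟨t₀, j, r, hk, ht₀, hr, hrun, hgood, hint⟩ := exists_last_restart hf_diff hf_conv hψ
    hxstar hv hμ hF hp hτ hESO hS_meas hS_indep hS_law hx₀ hσ hK he k
  have hdep : DependsOn (fun T => (restartedApprox f ψ v (tau p) σ K e x₀ T t₀).x)
      (Set.Iio t₀) := fun T T' hT => congrArg State.x (dependsOn_restartedApprox t₀ hT)
  have hx := ae_run_x_mem_domain (f := f) (t₀ := t₀) (a := fun T =>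
    (restartedApprox f ψ v (tau p) σ K e x₀ T t₀).x) hψ hv hp hτ hS_law hgood r
  have hi := integrable_of_dependsOn (P := P) hS_meas (dependsOn_run (f := f) (ψ := ψ) (v := v)
    (τ := tau p) (k := r) hdep fun s => realDelta f ψ v (tau p / n) xstar s.x)
  have hle := integral_realDelta_run_le hf_diff hf_conv hψ hxstar hv hp hτ hESO hS_meas hS_indep
    hS_law hdep hgood hμ hF r
  refine ⟨j, r, by rw [hk, ht₀], hr, ?_⟩
  simp only [hk, hrun]
  rw [Delta_eq_ofReal hψ hv hxstar hθ1 hx₀,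
    ← ENNReal.ofReal_mul (pow_nonneg (hσ.1.le.trans (le_max_left _ _)) _)]
  calc _ = ∫⁻ ω, ENNReal.ofReal (realDelta f ψ v (tau p / n) xstar
        (run f ψ v (tau p) (restartedApprox f ψ v (tau p) σ K e x₀ (fun t => S t ω) t₀).x
          (fun j => S (t₀ + j) ω) r).x) ∂P := by
        refine lintegral_congr_ae ?_
        filter_upwards [hx] with ω hω
        exact Delta_eq_ofReal hψ hv hxstar hθ1 hω
    _ = ENNReal.ofReal (∫ ω, realDelta f ψ v (tau p / n) xstar
        (run f ψ v (tau p) (restartedApprox f ψ v (tau p) σ K e x₀ (fun t => S t ω) t₀).x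
          (fun j => S (t₀ + j) ω) r).x ∂P) := by
        refine (ofReal_integral_eq_lintegral_ofReal hi ?_).symm
        filter_upwards [hx] with ω hω
        exact realDelta_nonneg hψ hv hxstar hθ1 hω
    _ ≤ _ := ENNReal.ofReal_le_ofReal (hle.trans hint)

end Restart

end RestartedApprox

/-! ### The linear rate -/

open RestartedApprox in
theorem mainTheorem2 {n : ℕ}
    (f : (Fin n → ℝ) → ℝ) (hf_diff : Differentiable ℝ f) (hf_conv : ConvexOn ℝ Set.univ f)
    (ψ : Fin n → ℝ → EReal) (hψ : ∀ i, IsClosedConvexFun (ψ i))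
    (xstar : Fin n → ℝ) (hxstar : ∀ x, objective f ψ xstar ≤ objective f ψ x)
    (v : Fin n → ℝ) (hv : ∀ i, 0 < v i)
    (μ : ℝ) (hμ : 0 < μ) (hF : StrongConvexityAt f ψ v xstar μ)
    (p : PMF (Finset (Fin n))) (hp : IsUniformSampling p) (hτ : 0 < tau p) (hESO : ESO f p v)
    {Ω : Type*} [MeasurableSpace Ω] (P : Measure Ω) [IsProbabilityMeasure P]
    (S : ℕ → Ω → Finset (Fin n)) (hS_meas : ∀ k, Measurable[_, ⊤] (S k))
    (hS_indep : iIndepFun (m := fun _ => ⊤) S P) (hS_law : ∀ k A, P (S k ⁻¹' {A}) = p A)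
    (x₀ : Fin n → ℝ) (σ : ℝ) (hσ : σ ∈ Set.Ioo (0 : ℝ) 1) (K : ℕ) (hK : 1 ≤ K)
    (e : ℕ) (he : e = 0 ∨ e = 1) :
    (max σ (1 - σ * mCoeff (tau p / n) K μ)) ^ (1 / (K : ℝ)) ∈ Set.Ioo (0 : ℝ) 1 ∧
    ∀ k, K ≤ k →
      ∫⁻ ω, Delta f ψ v (tau p / n) xstar
          (restartedApprox f ψ v (tau p) σ K e x₀ (fun t => S t ω) k).x ∂P ≤
        ENNReal.ofReal
            (((max σ (1 - σ * mCoeff (tau p / n) K μ)) ^ (1 / (K : ℝ))) ^ (k - K)) *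
          Delta f ψ v (tau p / n) xstar x₀ := by
  have hθ := tau_div_pos hτ
  have hθ1 := tau_div_le_one hτ
  have hK0 : (0 : ℝ) < K := by exact_mod_cast hK
  have hq0 : 0 < max σ (1 - σ * mCoeff (tau p / n) K μ) := hσ.1.trans_le (le_max_left _ _)
  have hq1 : max σ (1 - σ * mCoeff (tau p / n) K μ) < 1 := by
    have := mul_pos hσ.1 (mCoeff_pos hθ hθ1 hμ K)
    exact max_lt hσ.2 (by linarith)
  have hρ0 : 0 < max σ (1 - σ * mCoeff (tau p / n) K μ) ^ (1 / (K : ℝ)) :=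
    Real.rpow_pos_of_pos hq0 _
  have hρ1 : max σ (1 - σ * mCoeff (tau p / n) K μ) ^ (1 / (K : ℝ)) < 1 :=
    Real.rpow_lt_one hq0.le hq1 (by positivity)
  refine ⟨⟨hρ0, hρ1⟩, fun k hk => ?_⟩
  by_cases hx₀ : x₀ ∈ domain ψ ∨ tau p / n = 1
  · obtain ⟨j, r, hkj, hr, hle⟩ := lintegral_Delta_le hf_diff hf_conv hψ hxstar hv hμ hF hp hτ hESO
      hS_meas hS_indep hS_law hx₀ hσ hK he (k - (1 - e))
    rw [Nat.add_sub_cancel' (by omega : 1 - e ≤ k)] at hkj hle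
    refine hle.trans ?_
    gcongr
    calc max σ (1 - σ * mCoeff (tau p / n) K μ) ^ j
        = (max σ (1 - σ * mCoeff (tau p / n) K μ) ^ (1 / (K : ℝ))) ^ (K * j) := by
          rw [pow_mul, ← Real.rpow_natCast _ K, ← Real.rpow_mul hq0.le,
            one_div_mul_cancel hK0.ne', Real.rpow_one]
      _ ≤ _ := by
          -- Since `k = j K + (1 - e) + r` with `r < K` and `1 - e ≤ 1`, we have `k - K ≤ j K`.
          refine pow_le_pow_of_le_one hρ0.le hρ1.le ?_
          rw [mul_comm K j]
          omega
  -- Otherwise `Δ(x₀) = ∞`, and it is multiplied by a positive power of `ρ`.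
  · rw [Delta_eq_top hψ hxstar hθ hθ1 hx₀, ENNReal.mul_top]
    · exact le_top
    · exact (ENNReal.ofReal_pos.2 (pow_pos hρ0 _)).ne'
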